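/- Let $\kappa$ be either an infinite regular cardinal or the symbol $\infty$, which is deemed greater than every cardinal and ordinal; $\mathcal P_{<\kappa}X$ is the set of subsets of $X$ of size $<\kappa$, and $\mathcal P_{<\infty}=\mathcal P$ is the full powerset. The ordinal $0$ is deemed a limit. **Pointed systems.** A pointed system is a set $X$ with a relation $\rightsquigarrow$ and an element $x\in X$; it is $<\kappa$-branching if every $y$ with $x\rightsquigarrow^* y$ has $<\kappa$ many successors. The relations $\sim_i$ ($i$ an ordinal) between pointed systems are given by: $x\sim_{i+1}x'$ when for every $x\rightsquigarrow y$ there is $x'\rightsquigarrow y'$ with $y\sim_i y'$, and vice versa; for $i$ a limit, $x\sim_i x'$ when $x\sim_j x'$ for all $j<i$. **Final chain.** The final chain of $\mathcal P_{<\kappa}$ consists of sets $\nu_i\mathcal P_{<\kappa}$ and connecting maps $\nu_j^i:\nu_i\mathcal P_{<\kappa}\to\nu_j\mathcal P_{<\kappa}$ for ordinals $j\le i$, forming a functor $\mathsf{Ord}^{\mathrm{op}}\to\mathbf{Set}$: $\nu_{i+1}\mathcal P_{<\kappa}=\mathcal P_{<\kappa}(\nu_i\mathcal P_{<\kappa})$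 and $\nu_{j+1}^{i+1}a=\{\nu_j^i b\mid b\in a\}$; for a limit $i$, $\nu_i\mathcal P_{<\kappa}$ is the set of tuples $(a_j)_{j<i}$ with $a_j\in\nu_j\mathcal P_{<\kappa}$ and $\nu_k^j a_j=a_k$ for $k\le j<i$, and $\nu_j^i$ is the $j$th projection for $j<i$. We regard $\nu_i\mathcal P_{<\kappa}$ as a subset of $\nu_i\mathcal P$. The elements of all the sets $\nu_i\mathcal P$ are regarded as states of one transition system: if $a\in\nu_{i+1}\mathcal P$, then $a\rightsquigarrow b$ iff $b\in\nu_i\mathcal P$ and $b\in a$; if $i$ is a limit and $a\in\nu_i\mathcal P$, then $a\rightsquigarrow b$ iff $b\in\nu_i\mathcal P$ and $b_j\in a_{j+1}$ for all $j<i$. For a pointed system $x$, the elements $p_i(x)\in\nu_i\mathcal P$ are given by $p_{i+1}(x)=\{p_i(y)\mid x\rightsquigarrow y\}$ and $p_i(x)=(p_j(x))_{j<i}$ for $i$ a limit. **Ordinals.** Write an ordinal $i$ uniquely as $L(i)+n(i)$ with $L(i)$ a limit (its limit part) and $n(i)\in\mathbb N$ (its finite part). For a regular infinite cardinal $\lambda$,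 a tidy $\lambda$-tree is a functor $D:\lambda^{\mathrm{op}}\to\mathbf{Set}$ with all connecting maps surjective, with $D_0$ nonempty, and such that for each limit $i<\lambda$ every compatible family $(x_j)_{j<i}$ with $x_j\in D_j$ extends to at most one compatible family $(x_j)_{j\le i}$. The cardinal $\lambda$ has the tree property if every tidy $\lambda$-tree with all levels of size $<\lambda$ has a compatible family $(x_i)_{i<\lambda}$; it is weakly compact if it has the tree property and $2^{\mu}<\lambda$ for all cardinals $\mu<\lambda$ (so $\aleph_0$ is weakly compact). A limit ordinal is $\kappa$-extensible if it is $0$, or the supremum of a strictly increasing sequence $(i_n)_{n\in\mathbb N}$, or a weakly compact cardinal, or (for $\kappa<\infty$) $\ge\kappa+\omega$, or (for $\kappa<\infty$) equal to $\kappa$ where $\kappa$ has the tree property. **Proposition.** 1. For every ordinal $j$, the following are equivalent: (a) every $<\kappa$-branching pointed system $x$ satisfies $x\sim_j p_j(x)$; (b) $j\ge\kappa$ (for $\kappa<\infty$), or $L(j)$ is $\kappa$-extensible. 2. For all ordinals $j\le i$, the following are equivalent: (a) every $a\in\nu_i\mathcal P_{<\kappa}$ satisfies $\nu_j^i a\sim_j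 a$; (b) $j=i$, or $j\le n(i)$, or $j\ge\kappa$ (for $\kappa<\infty$), or both $L(j)$ and $L(i)$ are $\kappa$-extensible. -/

import Mathlib

open Order Cardinal Ordinal

universe u v w

noncomputable section

namespace GhostChain

/-! Conventions. Sets are the types of `Type u`, ordinals are `Ordinal.{u}`, cardinals are
`Cardinal.{u}`. The bound `κ` is an element of `WithTop Cardinal.{u}`, where `⊤` is the symbol that
is greater than all cardinals and ordinals. The ordinal `0` counts as a limit, so "limit" is
Mathlib's `IsSuccPrelimit`. -/

/-! ### Sizes, transition systems, approximants to bisimilarity -/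

/-- `α` is `< κ`-sized. This always holds for `κ = ⊤`. -/
def SizeLT (κ : WithTop Cardinal.{u}) (α : Type v) : Prop :=
  ∀ c : Cardinal.{u}, κ = (c : WithTop Cardinal.{u}) →
    Cardinal.lift.{u} #α < Cardinal.lift.{v} c

/-- `κ ≤ j` for an ordinal `j`; it never holds for `κ = ⊤`. -/
def BoundLE (κ : WithTop Cardinal.{u}) (j : Ordinal.{u}) : Prop :=
  ∃ c : Cardinal.{u}, κ = (c : WithTop Cardinal.{u}) ∧ c.ord ≤ j

/-- `κ` is infinite and regular, where `⊤` is deemed regular. -/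
def BoundRegular (κ : WithTop Cardinal.{u}) : Prop :=
  ∀ c : Cardinal.{u}, κ = (c : WithTop Cardinal.{u}) → c.IsRegular

/-- The pointed system `x` (in the transition system with transition relation `r`) is
`< κ`-branching. -/
def IsBranching (κ : WithTop Cardinal.{u}) {X : Type v} (r : X → X → Prop) (x : X) : Prop :=
  ∀ y, Relation.ReflTransGen r x y → SizeLT κ {z // r y z}

/-- `Approx r s i x y` is the relation `x ∼ᵢ y` between the pointed systems `x` (in the transition
system `r`) and `y` (in the transition system `s`). -/
def Approx {X : Type v} {Y : Type w} (r : X → X → Prop) (s : Y → Y → Prop) (i : Ordinal.{u}) :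
    X → Y → Prop :=
  SuccOrder.prelimitRecOn (motive := fun _ => X → Y → Prop) i
    (fun _ _ S x y =>
      (∀ x', r x x' → ∃ y', s y y' ∧ S x' y') ∧ (∀ y', s y y' → ∃ x', r x x' ∧ S x' y'))
    (fun i _ S x y => ∀ j (hj : j < i), S j hj x y)

/-! ### Inverse chains and trees -/

/-- An inverse `I`-chain. -/
structure InverseChain (I : Type v) [LinearOrder I] where
  level : I → Type w
  conn : ∀ {j i : I}, j ≤ i → level i → level j
  conn_self : ∀ (i : I) (a : level i), conn (le_refl i) a = a
  conn_conn : ∀ {k j i : I} (hkj : k ≤ j) (hji : j ≤ i) (a : level i),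
    conn hkj (conn hji a) = conn (hkj.trans hji) a

namespace InverseChain

variable {I : Type v} [LinearOrder I]

/-- A full branch of an inverse chain. -/
def IsFullBranch (D : InverseChain.{v, w} I) (x : ∀ i, D.level i) : Prop :=
  ∀ (j i : I) (h : j ≤ i), D.conn h (x i) = x j

/-- A tidy tree: connecting maps are surjective; a full branch through the levels below a limit
has at most one extension to the limit level; there is a root. -/
structure IsTidy (D : InverseChain.{v, w} I) : Prop where
  surjective : ∀ (j i : I) (h : j ≤ i), Function.Surjective (D.conn h)
  limit : ∀ i : I, IsSuccPrelimit i → ∀ x y : D.level i,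
    (∀ (j : I) (h : j < i), D.conn h.le x = D.conn h.le y) → x = y
  root : ∃ i : I, IsBot i ∧ Nonempty (D.level i)

end InverseChain

/-! ### The ordinals occurring in the classification -/

/-- `i` is the supremum of a strictly increasing `ω`-sequence of ordinals. -/
def IsOmegaCofinal (i : Ordinal.{u}) : Prop :=
  ∃ f : ℕ → Ordinal.{u}, StrictMono f ∧ IsLUB (Set.range f) i

/-- The tree property: every tidy `c`-tree with all levels `< c`-sized has a full branch. -/
def TreeProperty (c : Cardinal.{u}) : Prop :=
  ∀ D : InverseChain.{u + 1, u} (Set.Iio c.ord),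
    D.IsTidy → (∀ i, #(D.level i) < c) → ∃ x, D.IsFullBranch x

/-- Strong inaccessibility of a regular infinite cardinal; `ℵ₀` is not excluded. -/
def StronglyInaccessible (c : Cardinal.{u}) : Prop :=
  c.IsRegular ∧ ∀ A : Type u, #A < c → #(Set A) < c

/-- Weak compactness of a regular infinite cardinal; `ℵ₀` is not excluded. -/
def WeaklyCompact (c : Cardinal.{u}) : Prop :=
  StronglyInaccessible c ∧ TreeProperty c

/-- The `κ`-extensible limit ordinals. -/
inductive Extensible (κ : WithTop Cardinal.{u}) : Ordinal.{u} → Prop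
  | zero : Extensible κ 0
  | omegaCofinal (i : Ordinal.{u}) : IsOmegaCofinal i → Extensible κ i
  | weaklyCompact (c : Cardinal.{u}) : WeaklyCompact c → Extensible κ c.ord
  | large (c : Cardinal.{u}) (i : Ordinal.{u}) : κ = (c : WithTop Cardinal.{u}) →
      IsSuccPrelimit i → c.ord + ω ≤ i → Extensible κ i
  | bound (c : Cardinal.{u}) : κ = (c : WithTop Cardinal.{u}) → TreeProperty c →
      Extensible κ c.ord

/-- The limit part of an ordinal. -/
def limitPart (i : Ordinal.{u}) : Ordinal.{u} := ω * (i / ω)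

/-- The finite part of an ordinal. -/
def finitePart (i : Ordinal.{u}) : Ordinal.{u} := i % ω

/-- `limitPart` and `finitePart` give the decomposition of an ordinal as limit plus natural
number. -/
theorem limitPart_finitePart (i : Ordinal.{u}) :
    IsSuccPrelimit (limitPart i) ∧ (∃ n : ℕ, finitePart i = n) ∧
      limitPart i + finitePart i = i := by
  refine ⟨?_, Ordinal.lt_omega0.1 (Ordinal.mod_lt i Ordinal.omega0_ne_zero),
    Ordinal.div_add_mod i ω⟩
  rw [limitPart, Ordinal.isSuccPrelimit_iff_omega0_dvd]
  exact dvd_mul_right _ _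

/-! ### The final chain

`Raw i` is the set of hereditary families with the shape of an element of the `i`th level: a subset
of `Raw j` at `i = succ j`, a tuple with `j`th component in `Raw j` for `j < i` at a limit `i`.
The `i`th level of the final chain of `P_{<κ}` is the set of those `a : Raw i` in which all
subsets that occur are `< κ`-sized and all tuples that occur are full branches. -/

/-- The shapes at index `i`. -/
def Raw (i : Ordinal.{u}) : Type (u + 1) :=
  SuccOrder.prelimitRecOn (motive := fun _ => Type (u + 1)) i
    (fun _ _ R => Set R) (fun i _ R => ∀ j : Set.Iio i, R j.1 j.2)

namespace Raw

theorem eq_succ (i : Ordinal.{u}) : Raw (succ i) = Set (Raw i) :=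
  SuccOrder.prelimitRecOn_succ (motive := fun _ => Type (u + 1)) _ _ i

theorem eq_limit {i : Ordinal.{u}} (hi : IsSuccPrelimit i) :
    Raw i = ∀ j : Set.Iio i, Raw j.1 :=
  SuccOrder.prelimitRecOn_of_isSuccPrelimit (motive := fun _ => Type (u + 1)) _ _ hi

/-- At a successor index, shapes are subsets. -/
def succEquiv (i : Ordinal.{u}) : Raw (succ i) ≃ Set (Raw i) := Equiv.cast (eq_succ i)

/-- At a limit index, shapes are tuples. -/
def limitEquiv {i : Ordinal.{u}} (hi : IsSuccPrelimit i) : Raw i ≃ ∀ j : Set.Iio i, Raw j.1 :=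
  Equiv.cast (eq_limit hi)

/-- All levels are small sets, so the full power set may be used at successor indices. -/
instance small (i : Ordinal.{u}) : Small.{u} (Raw i) := by
  induction i using SuccOrder.prelimitRecOn with
  | succ i _ ih => exact small_map (succEquiv i)
  | isSuccPrelimit i hi ih =>
    have : ∀ j : Set.Iio i, Small.{u} (Raw j.1) := fun j => ih j.1 j.2
    exact small_map (limitEquiv hi)

/-- The connecting map from index `i` to `j ≤ i`. From a limit to a smaller index it is the
projection; from a successor to a successor it is the image under the connecting map of the
predecessors; from a successor to a limit it is forced by commutation with the projections. -/
def conn (i : Ordinal.{u}) : ∀ j, j ≤ i → Raw i → Raw j :=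
  SuccOrder.prelimitRecOn (motive := fun i => ∀ j, j ≤ i → Raw i → Raw j) i
    (fun i _ c j hj a =>
      SuccOrder.prelimitRecOn (motive := fun j => j ≤ succ i → Raw j) j
        (fun j _ _ hj => (succEquiv j).symm (c j (succ_le_succ_iff.1 hj) '' succEquiv i a))
        (fun _ hl d hj => (limitEquiv hl).symm fun k => d k.1 k.2 (k.2.le.trans hj)) hj)
    (fun i hi _ j hj a =>
      open scoped Classical in
      if h : j < i then limitEquiv hi a ⟨j, h⟩
      else cast (congrArg Raw (le_antisymm hj (not_lt.1 h)).symm) a)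

theorem conn_succ_succ {i j : Ordinal.{u}} (h : j ≤ i) (a : Raw (succ i)) :
    conn (succ i) (succ j) (succ_le_succ h) a
      = (succEquiv j).symm (conn i j h '' succEquiv i a) := by
  rw [conn, SuccOrder.prelimitRecOn_succ, SuccOrder.prelimitRecOn_succ]
  rfl

theorem conn_succ_limit {i j : Ordinal.{u}} (hj : IsSuccPrelimit j) (h : j ≤ succ i)
    (a : Raw (succ i)) (k : Set.Iio j) :
    limitEquiv hj (conn (succ i) j h a) k = conn (succ i) k.1 (k.2.le.trans h) a := by
  rw [conn, SuccOrder.prelimitRecOn_succ,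
    SuccOrder.prelimitRecOn_of_isSuccPrelimit (motive := fun j => j ≤ succ i → Raw j) _ _ hj,
    Equiv.apply_symm_apply]

theorem conn_limit {i j : Ordinal.{u}} (hi : IsSuccPrelimit i) (h : j < i) (a : Raw i) :
    conn i j h.le a = limitEquiv hi a ⟨j, h⟩ := by
  rw [conn, SuccOrder.prelimitRecOn_of_isSuccPrelimit
    (motive := fun i => ∀ j, j ≤ i → Raw i → Raw j) _ _ hi]
  exact dif_pos h

theorem conn_self (i : Ordinal.{u}) (a : Raw i) : conn i i le_rfl a = a := by
  induction i using SuccOrder.prelimitRecOn with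
  | succ i _ ih =>
    rw [conn_succ_succ le_rfl, Equiv.symm_apply_eq]
    have : conn i i le_rfl = id := funext ih
    rw [this, Set.image_id]
  | isSuccPrelimit i hi ih =>
    rw [conn, SuccOrder.prelimitRecOn_of_isSuccPrelimit
      (motive := fun i => ∀ j, j ≤ i → Raw i → Raw j) _ _ hi]
    simp

/-- The `i`th level of the final chain of `P_{<κ}`, as a set of shapes. -/
def level (κ : WithTop Cardinal.{u}) (i : Ordinal.{u}) : Set (Raw i) :=
  SuccOrder.prelimitRecOn (motive := fun i => Set (Raw i)) i
    (fun i _ V => {a | SizeLT κ (succEquiv i a) ∧ succEquiv i a ⊆ V})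
    (fun i hi V => {a | (∀ j : Set.Iio i, limitEquiv hi a j ∈ V j.1 j.2) ∧
      ∀ (k j : Set.Iio i) (h : k ≤ j), conn j.1 k.1 h (limitEquiv hi a j) = limitEquiv hi a k})

variable {κ : WithTop Cardinal.{u}}

theorem mem_level_succ {i : Ordinal.{u}} {a : Raw (succ i)} :
    a ∈ level κ (succ i) ↔ SizeLT κ (succEquiv i a) ∧ succEquiv i a ⊆ level κ i := by
  rw [level, SuccOrder.prelimitRecOn_succ]
  rfl

theorem mem_level_limit {i : Ordinal.{u}} (hi : IsSuccPrelimit i) {a : Raw i} :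
    a ∈ level κ i ↔ (∀ j : Set.Iio i, limitEquiv hi a j ∈ level κ j.1) ∧
      ∀ (k j : Set.Iio i) (h : k ≤ j),
        conn j.1 k.1 h (limitEquiv hi a j) = limitEquiv hi a k := by
  rw [level, SuccOrder.prelimitRecOn_of_isSuccPrelimit
    (motive := fun i => Set (Raw i)) _ _ hi]
  rfl

theorem sizeLT_image {α β : Type v} (f : α → β) {s : Set α} (h : SizeLT κ s) :
    SizeLT κ (f '' s) := fun c hc =>
  (Cardinal.lift_le.2 Cardinal.mk_image_le).trans_lt (h c hc)

theorem conn_mem_and_conn_conn (i : Ordinal.{u}) : ∀ a ∈ level κ i, ∀ j (hj : j ≤ i),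
    conn i j hj a ∈ level κ j ∧
      ∀ k (hk : k ≤ j), conn j k hk (conn i j hj a) = conn i k (hk.trans hj) a := by
  induction i using SuccOrder.prelimitRecOn with
  | isSuccPrelimit i hi ih =>
    intro a ha j hj
    rcases hj.lt_or_eq with h | rfl
    · obtain ⟨h1, h2⟩ := (mem_level_limit hi).1 ha
      rw [conn_limit hi h]
      refine ⟨h1 ⟨j, h⟩, fun k hk => ?_⟩
      rw [conn_limit hi (hk.trans_lt h)]
      exact h2 ⟨k, _⟩ ⟨j, h⟩ hk
    · rw [conn_self]
      exact ⟨ha, fun k hk => rfl⟩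
  | succ i _ ih =>
    intro a ha j
    obtain ⟨h1, h2⟩ := mem_level_succ.1 ha
    induction j using SuccOrder.prelimitRecOn with
    | isSuccPrelimit j hl ihj =>
      intro hj
      refine ⟨(mem_level_limit hl).2 ⟨fun k => ?_, fun l k h => ?_⟩, fun k hk => ?_⟩
      · rw [conn_succ_limit]
        exact (ihj k.1 k.2 _).1
      · rw [conn_succ_limit, conn_succ_limit]
        exact (ihj k.1 k.2 _).2 _ h
      · rcases hk.lt_or_eq with h | rfl
        · rw [conn_limit hl h, conn_succ_limit]
        · rw [conn_self]
    | succ j _ _ =>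
      intro hj
      have hji : j ≤ i := succ_le_succ_iff.1 hj
      refine ⟨?_, fun k => ?_⟩
      · rw [conn_succ_succ hji, mem_level_succ, Equiv.apply_symm_apply]
        refine ⟨sizeLT_image _ h1, ?_⟩
        rintro _ ⟨b, hb, rfl⟩
        exact (ih b (h2 hb) j hji).1
      · induction k using SuccOrder.prelimitRecOn with
        | isSuccPrelimit k hl ihk =>
          intro hk
          apply (limitEquiv hl).injective
          funext l
          rw [conn_succ_limit, conn_succ_limit]
          exact ihk l.1 l.2 _
        | succ k _ _ =>
          intro hk
          have hkj : k ≤ j := succ_le_succ_iff.1 hk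
          rw [conn_succ_succ hji, conn_succ_succ hkj, conn_succ_succ (hkj.trans hji),
            Equiv.apply_symm_apply, Set.image_image]
          congr 1
          exact Set.image_congr fun b hb => (ih b (h2 hb) j hji).2 k hkj

theorem level_subset_top (i : Ordinal.{u}) : level κ i ⊆ level ⊤ i := by
  induction i using SuccOrder.prelimitRecOn with
  | isSuccPrelimit i hi ih =>
    intro a ha
    obtain ⟨h1, h2⟩ := (mem_level_limit hi).1 ha
    exact (mem_level_limit hi).2 ⟨fun j => ih j.1 j.2 (h1 j), h2⟩
  | succ i _ ih =>
    intro a ha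
    obtain ⟨h1, h2⟩ := mem_level_succ.1 ha
    exact mem_level_succ.2 ⟨fun c hc => (WithTop.top_ne_coe hc).elim, h2.trans ih⟩

/-- The `i`th coalgebra projection of the transition system `r`, as a shape. -/
def proj {X : Type v} (r : X → X → Prop) (i : Ordinal.{u}) : X → Raw i :=
  SuccOrder.prelimitRecOn (motive := fun i => X → Raw i) i
    (fun i _ p x => (succEquiv i).symm (p '' {y | r x y}))
    (fun _ hi p x => (limitEquiv hi).symm fun j => p j.1 j.2 x)

variable {X : Type v} (r : X → X → Prop)

theorem proj_succ (i : Ordinal.{u}) (x : X) :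
    proj r (succ i) x = (succEquiv i).symm (proj r i '' {y | r x y}) := by
  rw [proj, SuccOrder.prelimitRecOn_succ]
  rfl

theorem proj_limit {i : Ordinal.{u}} (hi : IsSuccPrelimit i) (x : X) (j : Set.Iio i) :
    limitEquiv hi (proj r i x) j = proj r j.1 x := by
  rw [proj, SuccOrder.prelimitRecOn_of_isSuccPrelimit (motive := fun i => X → Raw i) _ _ hi,
    Equiv.apply_symm_apply]
  rfl

theorem conn_proj (i : Ordinal.{u}) : ∀ (x : X) (j) (hj : j ≤ i),
    conn i j hj (proj r i x) = proj r j x := by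
  induction i using SuccOrder.prelimitRecOn with
  | isSuccPrelimit i hi ih =>
    intro x j hj
    rcases hj.lt_or_eq with h | rfl
    · rw [conn_limit hi h, proj_limit]
    · rw [conn_self]
  | succ i _ ih =>
    intro x j
    induction j using SuccOrder.prelimitRecOn with
    | isSuccPrelimit j hl ihj =>
      intro hj
      apply (limitEquiv hl).injective
      funext k
      rw [conn_succ_limit, proj_limit]
      exact ihj k.1 k.2 _
    | succ j _ _ =>
      intro hj
      have hji : j ≤ i := succ_le_succ_iff.1 hj
      rw [conn_succ_succ hji, proj_succ, proj_succ, Equiv.apply_symm_apply, Set.image_image]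
      congr 1
      exact Set.image_congr fun b _ => ih b j hji

theorem proj_mem_top (i : Ordinal.{u}) (x : X) : proj r i x ∈ level ⊤ i := by
  induction i using SuccOrder.prelimitRecOn generalizing x with
  | isSuccPrelimit i hi ih =>
    refine (mem_level_limit hi).2 ⟨fun j => ?_, fun k j h => ?_⟩
    · rw [proj_limit]
      exact ih j.1 j.2 x
    · rw [proj_limit, proj_limit, conn_proj]
  | succ i _ ih =>
    refine mem_level_succ.2 ⟨fun c hc => (WithTop.top_ne_coe hc).elim, ?_⟩
    rw [proj_succ, Equiv.apply_symm_apply]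
    rintro _ ⟨y, _, rfl⟩
    exact ih y

end Raw

/-- The final chain of the functor `P_{<κ}`; for `κ = ⊤`, of the power set functor `P`. -/
def finalChain (κ : WithTop Cardinal.{u}) : InverseChain.{u + 1, u + 1} Ordinal.{u} where
  level i := Raw.level κ i
  conn {j i} h a := ⟨Raw.conn i j h a.1, (Raw.conn_mem_and_conn_conn i a.1 a.2 j h).1⟩
  conn_self i a := Subtype.ext (Raw.conn_self i a.1)
  conn_conn {k j i} hkj hji a :=
    Subtype.ext ((Raw.conn_mem_and_conn_conn i a.1 a.2 j hji).2 k hkj)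

/-- The inclusion of the final chain of `P_{<κ}` in the final chain of `P`. -/
def incl {κ : WithTop Cardinal.{u}} {i : Ordinal.{u}} (a : (finalChain κ).level i) :
    (finalChain (⊤ : WithTop Cardinal.{u})).level i :=
  ⟨a.1, Raw.level_subset_top i a.2⟩

/-- Membership of an element of the `i`th level in an element of the `i + 1`st level. -/
def Elem {κ : WithTop Cardinal.{u}} {i : Ordinal.{u}} (b : (finalChain κ).level i)
    (a : (finalChain κ).level (succ i)) : Prop :=
  b.1 ∈ Raw.succEquiv i a.1

/-- The coalgebra projection `pᵢ` of the transition system `r` (a coalgebra of `P`). -/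
def coalgProj {X : Type v} (r : X → X → Prop) (i : Ordinal.{u}) (x : X) :
    (finalChain (⊤ : WithTop Cardinal.{u})).level i :=
  ⟨Raw.proj r i x, Raw.proj_mem_top r i x⟩

/-- The elements of all levels of the final chain of `P`. -/
abbrev Node : Type (u + 1) :=
  Σ i : Ordinal.{u}, (finalChain (⊤ : WithTop Cardinal.{u})).level i

/-- The transition relation on the final chain of `P`. An element at a successor index has
transitions to its elements, one level below; an element at a limit index (`0` included) has
transitions within its own level. -/
inductive Step : Node.{u} → Node.{u} → Prop
  | succ (i : Ordinal.{u}) (a : (finalChain (⊤ : WithTop Cardinal.{u})).level (succ i))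
      (b : (finalChain (⊤ : WithTop Cardinal.{u})).level i) :
      Elem b a → Step ⟨succ i, a⟩ ⟨i, b⟩
  | limit (i : Ordinal.{u}) (hi : IsSuccPrelimit i)
      (a b : (finalChain (⊤ : WithTop Cardinal.{u})).level i) :
      (∀ (j : Ordinal.{u}) (hj : j < i),
        Elem ((finalChain ⊤).conn hj.le b) ((finalChain ⊤).conn (succ_le_of_lt hj) a)) →
      Step ⟨i, a⟩ ⟨i, b⟩

end GhostChain

end

/-! Two pointed systems are `∼ᵢ`-related exactly when their images under `pᵢ` coincide
(`approx_iff_proj_eq`), so both parts ask how `pⱼ` acts on the states of the final chain itself. The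
ideal answer is `Faithful`: `pⱼ` of an element is its restriction to level `j`. The obstruction sits
at limits, where a member of a component `a_{j+1}` need not be the restriction of a successor of
`a`. If it always is (`ExtensionProperty`), induction on the stage gives faithfulness at that limit
and at the finite steps above it. All extensible limits have this property: lift along an
`ω`-sequence, apply the tree property to the tree of candidates, or, strictly above `κ`, use that
lifts are unique.

If `κ ≤ j`, faithfulness is not needed. A set of fewer than `κ` elements of level `κ` is closed: by
regularity it contains every element all of whose restrictions come from the set. Hence restriction
to a level `j ≥ κ` is a bisimulation (`proj_step_conn_eq`), and so is `pⱼ` on `< κ`-branching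
systems (`proj_step_proj_eq`).

Conversely, a limit `i` that is not extensible carries a tree of height `i` with small levels and no
full branch (`BranchlessTree.nonempty_of_not_extensible`). A transition system codes it so that
stage `k` sees level `k` of the tree only. The images of the tree levels form an element of level
`i`, the ghost. A successor of the ghost would be a full branch, so there is none, although all
restrictions of the ghost to levels `0 < j < i` have transitions. If moreover `κ ≤ i` fails, a root
whose successors are the tree levels acquires the ghost as a spurious successor at level `i`. Adding
singletons transports these failures to ordinals with nonzero finite part. -/

namespace GhostChain

/-! ### Sizes -/

theorem SizeLT.of_surjective {κ : WithTop Cardinal.{u}} {α : Type v} {β : Type w}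
    (h : SizeLT κ α) (f : α → β) (hf : Function.Surjective f) : SizeLT κ β := fun c hc => by
  have h1 : Cardinal.lift.{max u v} #β ≤ Cardinal.lift.{max u w} #α := by
    have := Cardinal.lift_le.{u}.2 (Cardinal.lift_mk_le_lift_mk_of_surjective hf)
    rw [Cardinal.lift_lift, Cardinal.lift_lift] at this
    exact this
  have h2 := Cardinal.lift_lt.{_, w}.2 (h c hc)
  rw [Cardinal.lift_lift, Cardinal.lift_lift] at h2
  have h3 := h1.trans_lt h2
  rw [← Cardinal.lift_lt.{_, v}, Cardinal.lift_lift, Cardinal.lift_lift]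
  exact h3

theorem SizeLT.of_injective {κ : WithTop Cardinal.{u}} {α : Type v} {β : Type w}
    (h : SizeLT κ α) (f : β → α) (hf : Function.Injective f) : SizeLT κ β := by
  intro c hc
  -- `Function.invFun` needs a point of `β`; for empty `β` only `c ≠ 0` is left to show.
  rcases isEmpty_or_nonempty β with h0 | h0
  · have h1 := (zero_le : 0 ≤ Cardinal.lift.{u} #α).trans_lt (h c hc)
    rw [Cardinal.mk_eq_zero, Cardinal.lift_zero]
    rw [pos_iff_ne_zero, Ne, Cardinal.lift_eq_zero] at h1
    rwa [pos_iff_ne_zero, Ne, Cardinal.lift_eq_zero]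
  · exact h.of_surjective (Function.invFun f) (Function.invFun_surjective hf) c hc

/-! ### Shapes and approximants -/

namespace Raw

variable {κ : WithTop Cardinal.{u}}

theorem ext_succ {i : Ordinal.{u}} {a b : Raw (succ i)}
    (h : ∀ c, c ∈ succEquiv i a ↔ c ∈ succEquiv i b) : a = b :=
  (succEquiv i).injective (Set.ext h)

theorem ext_limit {i : Ordinal.{u}} (hi : IsSuccPrelimit i) {a b : Raw i}
    (h : ∀ (j : Ordinal.{u}) (hj : j < i), conn i j hj.le a = conn i j hj.le b) : a = b := by
  apply (limitEquiv hi).injective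
  funext j
  have := h j.1 j.2
  rwa [conn_limit hi, conn_limit hi] at this

theorem mem_conn_succ {i j : Ordinal.{u}} (h : j ≤ i) (h' : succ j ≤ succ i) {a : Raw (succ i)}
    {b : Raw j} :
    b ∈ succEquiv j (conn (succ i) (succ j) h' a) ↔ ∃ c ∈ succEquiv i a, conn i j h c = b := by
  rw [conn_succ_succ h, Equiv.apply_symm_apply]
  rfl

theorem conn_conn {i j k : Ordinal.{u}} {a : Raw i} (ha : a ∈ level κ i) (hj : j ≤ i)
    (hk : k ≤ j) : conn j k hk (conn i j hj a) = conn i k (hk.trans hj) a :=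
  (conn_mem_and_conn_conn i a ha j hj).2 k hk

theorem conn_mem {i j : Ordinal.{u}} {a : Raw i} (ha : a ∈ level κ i) (hj : j ≤ i) :
    conn i j hj a ∈ level κ j :=
  (conn_mem_and_conn_conn i a ha j hj).1

theorem mem_level_of_mem {i : Ordinal.{u}} {a : Raw (succ i)} (ha : a ∈ level κ (succ i))
    {b : Raw i} (hb : b ∈ succEquiv i a) : b ∈ level κ i :=
  (mem_level_succ.1 ha).2 hb

theorem mem_proj_succ {X : Type v} {r : X → X → Prop} {i : Ordinal.{u}} {x : X} {b : Raw i} :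
    b ∈ succEquiv i (proj r (succ i) x) ↔ ∃ y, r x y ∧ proj r i y = b := by
  rw [proj_succ, Equiv.apply_symm_apply]
  rfl

theorem proj_eq_of_le {X : Type v} {Y : Type w} {r : X → X → Prop} {s : Y → Y → Prop}
    {i j : Ordinal.{u}} (hji : j ≤ i) {x : X} {y : Y} (h : proj r i x = proj s i y) :
    proj r j x = proj s j y := by
  rw [← conn_proj r i x j hji, h, conn_proj]

theorem proj_succ_eq_iff {X : Type v} {Y : Type w} {r : X → X → Prop} {s : Y → Y → Prop}
    {i : Ordinal.{u}} {x : X} {y : Y} : proj r (succ i) x = proj s (succ i) y ↔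
      (∀ x', r x x' → ∃ y', s y y' ∧ proj r i x' = proj s i y') ∧
        (∀ y', s y y' → ∃ x', r x x' ∧ proj r i x' = proj s i y') := by
  constructor
  · intro h
    refine ⟨fun x' hx' => ?_, fun y' hy' => ?_⟩
    · obtain ⟨y', h1, h2⟩ := mem_proj_succ.1 (h ▸ mem_proj_succ.2 ⟨x', hx', rfl⟩)
      exact ⟨y', h1, h2.symm⟩
    · obtain ⟨x', h1, h2⟩ := mem_proj_succ.1 (h.symm ▸ mem_proj_succ.2 ⟨y', hy', rfl⟩)
      exact ⟨x', h1, h2⟩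
  · rintro ⟨h1, h2⟩
    refine ext_succ fun c => ?_
    rw [mem_proj_succ, mem_proj_succ]
    constructor
    · rintro ⟨x', hx', rfl⟩
      obtain ⟨y', h, e⟩ := h1 x' hx'
      exact ⟨y', h, e.symm⟩
    · rintro ⟨y', hy', rfl⟩
      exact h2 y' hy'

theorem proj_limit_eq_iff {X : Type v} {Y : Type w} {r : X → X → Prop} {s : Y → Y → Prop}
    {i : Ordinal.{u}} (hi : IsSuccPrelimit i) {x : X} {y : Y} :
    proj r i x = proj s i y ↔ ∀ j < i, proj r j x = proj s j y := by
  refine ⟨fun h j hj => proj_eq_of_le hj.le h, fun h => ext_limit hi fun j hj => ?_⟩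
  rw [conn_proj, conn_proj, h j hj]

theorem proj_mem_level {X : Type v} (r : X → X → Prop) (i : Ordinal.{u}) (x : X)
    (hx : IsBranching κ r x) : proj r i x ∈ level κ i := by
  induction i using SuccOrder.prelimitRecOn generalizing x with
  | isSuccPrelimit i hi ih =>
    refine (mem_level_limit hi).2 ⟨fun j => ?_, fun k j h => ?_⟩
    · rw [proj_limit]
      exact ih j.1 j.2 x hx
    · rw [proj_limit, proj_limit, conn_proj]
  | succ i _ ih =>
    rw [mem_level_succ, proj_succ, Equiv.apply_symm_apply]
    refine ⟨(hx x .refl).of_surjective (fun z => ⟨proj r i z.1, z.1, z.2, rfl⟩) ?_, ?_⟩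
    · rintro ⟨_, y, hy, rfl⟩
      exact ⟨⟨y, hy⟩, rfl⟩
    rintro _ ⟨y, hy, rfl⟩
    exact ih y fun z hz => hx z (.head hy hz)

end Raw

/-- Both sides obey the same recursion on `i`: back and forth at successors, conjunction over the
smaller stages at limits. -/
theorem approx_iff_proj_eq {X : Type v} {Y : Type w} {r : X → X → Prop} {s : Y → Y → Prop}
    {i : Ordinal.{u}} {x : X} {y : Y} :
    Approx r s i x y ↔ Raw.proj r i x = Raw.proj s i y := by
  induction i using SuccOrder.prelimitRecOn generalizing x y with
  | isSuccPrelimit i hi ih =>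
    rw [Approx, SuccOrder.prelimitRecOn_of_isSuccPrelimit
      (motive := fun _ => X → Y → Prop) _ _ hi, Raw.proj_limit_eq_iff hi]
    exact forall₂_congr fun j hj => ih j hj
  | succ i _ ih =>
    rw [Approx, SuccOrder.prelimitRecOn_succ, Raw.proj_succ_eq_iff]
    simp only [← ih]
    rfl

/-! ### Transitions in the final chain -/

/-- The element `a` of the `i`th level as a state. -/
abbrev node {i : Ordinal.{u}} (a : Raw i) (ha : a ∈ Raw.level ⊤ i) : Node.{u} := ⟨i, ⟨a, ha⟩⟩

theorem step_succ_iff {i : Ordinal.{u}} {a : Raw (succ i)} {ha : a ∈ Raw.level ⊤ (succ i)}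
    {n : Node.{u}} : Step (node a ha) n ↔ ∃ (b : Raw i) (hb : b ∈ Raw.succEquiv i a),
      n = node b (Raw.mem_level_of_mem ha hb) := by
  constructor
  · intro h
    generalize hm : node a ha = m at h
    cases h with
    | succ i' a' b h =>
      obtain ⟨h1, h2⟩ := Sigma.mk.inj hm
      obtain rfl := succ_injective h1
      obtain rfl := eq_of_heq h2
      exact ⟨b.1, h, rfl⟩
    | limit i' hi' a' b h =>
      obtain ⟨rfl, h2⟩ := Sigma.mk.inj hm
      exact (not_isSuccPrelimit_succ i hi').elim
  · rintro ⟨b, hb, rfl⟩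
    exact .succ i ⟨a, ha⟩ ⟨b, _⟩ hb

/-- `b` is a successor of `a` at a limit level. -/
def LimitStep {i : Ordinal.{u}} (a b : Raw i) : Prop :=
  ∀ (j : Ordinal.{u}) (hj : j < i),
    Raw.conn i j hj.le b ∈ Raw.succEquiv j (Raw.conn i (succ j) (succ_le_of_lt hj) a)

theorem step_limit_iff {i : Ordinal.{u}} (hi : IsSuccPrelimit i) {a : Raw i}
    {ha : a ∈ Raw.level ⊤ i} {n : Node.{u}} :
    Step (node a ha) n ↔ ∃ (b : Raw i) (hb : b ∈ Raw.level ⊤ i), LimitStep a b ∧ n = node b hb := by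
  constructor
  · intro h
    generalize hm : node a ha = m at h
    cases h with
    | succ i' a' b h =>
      obtain ⟨rfl, h2⟩ := Sigma.mk.inj hm
      exact (not_isSuccPrelimit_succ i' hi).elim
    | limit i' hi' a' b h =>
      obtain ⟨rfl, h2⟩ := Sigma.mk.inj hm
      obtain rfl := eq_of_heq h2
      exact ⟨b.1, b.2, h, rfl⟩
  · rintro ⟨b, hb, h, rfl⟩
    exact .limit i hi ⟨a, ha⟩ ⟨b, hb⟩ h

/-- Limit transitions live in the chain of the full power set, but each `b_j` is a member of
`a_{j+1}` and so inherits the size bound. -/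
theorem mem_level_of_limitStep {κ : WithTop Cardinal.{u}} {i : Ordinal.{u}}
    (hi : IsSuccPrelimit i) {a b : Raw i} (ha : a ∈ Raw.level κ i) (hb : b ∈ Raw.level ⊤ i)
    (h : LimitStep a b) : b ∈ Raw.level κ i := by
  refine (Raw.mem_level_limit hi).2 ⟨fun j => ?_, ((Raw.mem_level_limit hi).1 hb).2⟩
  have := h j.1 j.2
  rw [Raw.conn_limit hi j.2] at this
  exact Raw.mem_level_of_mem (Raw.conn_mem ha _) this

theorem mem_proj_step_succ {i j : Ordinal.{u}} {a : Raw (succ i)}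
    {ha : a ∈ Raw.level ⊤ (succ i)} {c : Raw j} :
    c ∈ Raw.succEquiv j (Raw.proj Step (succ j) (node a ha)) ↔
      ∃ (b : Raw i) (hb : b ∈ Raw.succEquiv i a),
        Raw.proj Step j (node b (Raw.mem_level_of_mem ha hb)) = c := by
  rw [Raw.mem_proj_succ]
  constructor
  · rintro ⟨n, hn, rfl⟩
    obtain ⟨b, hb, rfl⟩ := step_succ_iff.1 hn
    exact ⟨b, hb, rfl⟩
  · rintro ⟨b, hb, rfl⟩
    exact ⟨_, step_succ_iff.2 ⟨b, hb, rfl⟩, rfl⟩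

theorem mem_proj_step_limit {i j : Ordinal.{u}} (hi : IsSuccPrelimit i) {a : Raw i}
    {ha : a ∈ Raw.level ⊤ i} {c : Raw j} :
    c ∈ Raw.succEquiv j (Raw.proj Step (succ j) (node a ha)) ↔
      ∃ (b : Raw i) (hb : b ∈ Raw.level ⊤ i), LimitStep a b ∧
        Raw.proj Step j (node b hb) = c := by
  rw [Raw.mem_proj_succ]
  constructor
  · rintro ⟨n, hn, rfl⟩
    obtain ⟨b, hb, h, rfl⟩ := (step_limit_iff hi).1 hn
    exact ⟨b, hb, h, rfl⟩
  · rintro ⟨b, hb, h, rfl⟩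
    exact ⟨_, (step_limit_iff hi).2 ⟨b, hb, h, rfl⟩, rfl⟩

/-! ### Faithful levels -/

/-- At the limit `i`, every element of a component of an element extends to a successor. -/
def ExtensionProperty (κ : WithTop Cardinal.{u}) (i : Ordinal.{u}) : Prop :=
  ∀ a ∈ Raw.level κ i, ∀ (j : Ordinal.{u}) (hj : j < i),
    ∀ b ∈ Raw.succEquiv j (Raw.conn i (succ j) (succ_le_of_lt hj) a),
      ∃ c ∈ Raw.level κ i, LimitStep a c ∧ Raw.conn i j hj.le c = b

/-- Up to stage `j`, elements of level `i` behave as their restrictions prescribe. -/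
def Faithful (κ : WithTop Cardinal.{u}) (j i : Ordinal.{u}) : Prop :=
  ∀ (h : j ≤ i) (a : Raw i) (ha : a ∈ Raw.level κ i),
    Raw.proj Step j (node a (Raw.level_subset_top i ha)) = Raw.conn i j h a

theorem Faithful.of_limit {κ : WithTop Cardinal.{u}} {j i : Ordinal.{u}} (hj : IsSuccPrelimit j)
    (H : ∀ k < j, Faithful κ k i) : Faithful κ j i := by
  refine fun h a ha => Raw.ext_limit hj fun k hk => ?_
  rw [Raw.conn_proj, Raw.conn_conn ha, H k hk (hk.le.trans h) a ha]

theorem Faithful.succ_succ {κ : WithTop Cardinal.{u}} {j i : Ordinal.{u}}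
    (H : Faithful κ j i) : Faithful κ (succ j) (succ i) := by
  refine fun h a ha => Raw.ext_succ fun c => ?_
  have hji : j ≤ i := succ_le_succ_iff.1 h
  rw [mem_proj_step_succ, Raw.mem_conn_succ hji]
  constructor
  · rintro ⟨b, hb, rfl⟩
    exact ⟨b, hb, (H hji b (Raw.mem_level_of_mem ha hb)).symm⟩
  · rintro ⟨b, hb, rfl⟩
    exact ⟨b, hb, H hji b (Raw.mem_level_of_mem ha hb)⟩

/-- By induction, the successors `b` of `a` contribute their restrictions `b_j` at stage `j + 1`.
These lie in `a_{j+1}` by definition of the transitions, and the extension property says that they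
exhaust it. -/
theorem ExtensionProperty.faithful {κ : WithTop Cardinal.{u}} {i : Ordinal.{u}}
    (hi : IsSuccPrelimit i) (H : ExtensionProperty κ i) (j : Ordinal.{u}) : Faithful κ j i := by
  induction j using SuccOrder.prelimitRecOn with
  | isSuccPrelimit j hj ih => exact .of_limit hj ih
  | succ j _ ih =>
    refine fun h a ha => Raw.ext_succ fun c => ?_
    have hji : j < i := succ_le_iff.1 h
    rw [mem_proj_step_limit hi]
    constructor
    · rintro ⟨b, hb, hab, rfl⟩
      rw [ih hji.le b (mem_level_of_limitStep hi ha hb hab)]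
      exact hab j hji
    · intro hc
      obtain ⟨b, hb, hab, rfl⟩ := H a ha j hji c hc
      exact ⟨b, Raw.level_subset_top i hb, hab, ih hji.le b hb⟩

theorem Faithful.succ_of_forall {κ : WithTop Cardinal.{u}} {i : Ordinal.{u}}
    (H : ∀ j, Faithful κ j i) (j : Ordinal.{u}) : Faithful κ j (succ i) := by
  induction j using SuccOrder.prelimitRecOn with
  | isSuccPrelimit j hj ih => exact .of_limit hj ih
  | succ j _ ih => exact (H j).succ_succ

theorem faithful_zero (κ : WithTop Cardinal.{u}) (i : Ordinal.{u}) : Faithful κ 0 i :=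
  .of_limit isSuccPrelimit_bot fun _ hk => (not_lt_bot hk).elim

/-- Stage `0` sees nothing, and each successor level gains one stage, whatever the limit part; this
is the case `j ≤ n(i)`. -/
theorem faithful_natCast (κ : WithTop Cardinal.{u}) (n : ℕ) (i : Ordinal.{u}) :
    Faithful κ n (i + n) := by
  induction n with
  | zero => rw [Nat.cast_zero]; exact faithful_zero κ _
  | succ n ih =>
    rw [Nat.cast_succ, ← add_assoc, ← succ_eq_add_one, ← succ_eq_add_one]
    exact ih.succ_succ

theorem ExtensionProperty.faithful_add_natCast {κ : WithTop Cardinal.{u}} {i : Ordinal.{u}}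
    (hi : IsSuccPrelimit i) (H : ExtensionProperty κ i) (n : ℕ) (j : Ordinal.{u}) :
    Faithful κ j (i + n) := by
  induction n generalizing j with
  | zero => rw [Nat.cast_zero, add_zero]; exact H.faithful hi j
  | succ n ih =>
    rw [Nat.cast_succ, ← add_assoc, ← succ_eq_add_one]
    exact Faithful.succ_of_forall ih j

theorem Faithful.mono {κ : WithTop Cardinal.{u}} {k j i : Ordinal.{u}} (hkj : k ≤ j) (hji : j ≤ i)
    (H : Faithful κ j i) : Faithful κ k i := fun h a ha => by
  rw [← Raw.conn_proj Step j _ k hkj, H hji a ha, Raw.conn_conn ha]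

theorem ExtensionProperty.faithful_of_limitPart {κ : WithTop Cardinal.{u}} {i : Ordinal.{u}}
    (H : ExtensionProperty κ (limitPart i)) (j : Ordinal.{u}) : Faithful κ j i := by
  obtain ⟨h1, ⟨n, hn⟩, h3⟩ := limitPart_finitePart i
  have := H.faithful_add_natCast h1 n j
  rwa [← hn, h3] at this

theorem faithful_of_le_finitePart (κ : WithTop Cardinal.{u}) {j i : Ordinal.{u}}
    (h : j ≤ finitePart i) : Faithful κ j i := by
  obtain ⟨h1, ⟨n, hn⟩, h3⟩ := limitPart_finitePart i
  have := faithful_natCast κ n (limitPart i)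
  rw [← hn, h3] at this
  refine this.mono h ?_
  conv_rhs => rw [← h3]
  exact le_add_self

end GhostChain

/-! ### The extension property from `ω`-sequences and from the tree property -/

namespace GhostChain

variable {κ : WithTop Cardinal.{u}}

/-! ### Successors at limit levels -/

/-- The component `a_{k+1}` is the image of `a_{j+1}`, so members of a component lift to every
higher one. All lifts below come from this. -/
theorem mem_component_iff {i : Ordinal.{u}} {a : Raw i} (ha : a ∈ Raw.level κ i)
    {k j : Ordinal.{u}} (hkj : k ≤ j) (hj : succ j ≤ i) (hk : succ k ≤ i) {b : Raw k} :
    b ∈ Raw.succEquiv k (Raw.conn i (succ k) hk a) ↔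
      ∃ c ∈ Raw.succEquiv j (Raw.conn i (succ j) hj a), Raw.conn j k hkj c = b := by
  rw [← Raw.conn_conn ha hj (succ_le_succ hkj), Raw.mem_conn_succ hkj]

theorem mem_level_of_mem_component {i : Ordinal.{u}} {a : Raw i} (ha : a ∈ Raw.level κ i)
    {j : Ordinal.{u}} {hj : succ j ≤ i} {b : Raw j}
    (hb : b ∈ Raw.succEquiv j (Raw.conn i (succ j) hj a)) : b ∈ Raw.level κ j :=
  Raw.mem_level_of_mem (Raw.conn_mem ha hj) hb

/-- A compatible family of elements of the components at a cofinal set of indices determines a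
successor. -/
theorem exists_limitStep {ι : Type v} [LinearOrder ι] {i : Ordinal.{u}} (hi : IsSuccPrelimit i)
    {a : Raw i} (ha : a ∈ Raw.level κ i) (g : ι → Ordinal.{u}) (hg : Monotone g)
    (hgi : ∀ n, g n < i) (hcof : ∀ k < i, ∃ n, k ≤ g n) (s : ∀ n, Raw (g n))
    (hs : ∀ n, s n ∈ Raw.succEquiv (g n) (Raw.conn i (succ (g n)) (succ_le_of_lt (hgi n)) a))
    (hss : ∀ m n (h : m ≤ n), Raw.conn (g n) (g m) (hg h) (s n) = s m) :
    ∃ c ∈ Raw.level κ i, LimitStep a c ∧ ∀ n, Raw.conn i (g n) (hgi n).le c = s n := by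
  have hlev : ∀ n, s n ∈ Raw.level κ (g n) := fun n => mem_level_of_mem_component ha (hs n)
  choose N hN using hcof
  -- The `k`th coordinate is read off at an arbitrary index `g n ≥ k`; `hc` shows that the choice is
  -- immaterial.
  let c : ∀ k : Set.Iio i, Raw k.1 := fun k => Raw.conn (g (N k.1 k.2)) k.1 (hN k.1 k.2) (s (N k.1 k.2))
  have hc : ∀ (k : Set.Iio i) n (h : k.1 ≤ g n), c k = Raw.conn (g n) k.1 h (s n) := by
    intro k n h
    rcases le_total n (N k.1 k.2) with h' | h'
    · rw [← hss _ _ h', Raw.conn_conn (hlev _)]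
    · simp only [c]
      rw [← hss _ _ h', Raw.conn_conn (hlev _)]
  have hcoord : ∀ (k : Ordinal.{u}) (hk : k < i),
      Raw.conn i k hk.le ((Raw.limitEquiv hi).symm c) = c ⟨k, hk⟩ := fun k hk => by
    rw [Raw.conn_limit hi hk, Equiv.apply_symm_apply]
  refine ⟨(Raw.limitEquiv hi).symm c, (Raw.mem_level_limit hi).2 ⟨fun k => ?_, fun k l h => ?_⟩,
    fun k hk => ?_, fun n => ?_⟩
  · rw [Equiv.apply_symm_apply]
    exact Raw.conn_mem (hlev _) _
  · rw [Equiv.apply_symm_apply, hc k _ ((show k.1 ≤ l.1 from h).trans (hN l.1 l.2)),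
      ← Raw.conn_conn (hlev _) (hN l.1 l.2) h]
  · rw [hcoord k hk, mem_component_iff ha (hN k hk) (succ_le_of_lt (hgi _))]
    exact ⟨_, hs _, rfl⟩
  · rw [hcoord _ (hgi n), hc _ n le_rfl, Raw.conn_self]

theorem extensionProperty_zero : ExtensionProperty κ 0 :=
  fun _ _ _ hj => (not_lt_bot hj).elim

theorem isSuccPrelimit_of_isLUB_range {i : Ordinal.{u}} {f : ℕ → Ordinal.{u}} (hf : StrictMono f)
    (h : IsLUB (Set.range f) i) : IsSuccPrelimit i := by
  rw [isSuccPrelimit_iff_succ_lt]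
  intro b hb
  obtain ⟨_, ⟨n, rfl⟩, hn, -⟩ := h.exists_between hb
  exact (succ_le_of_lt hn).trans_lt ((hf n.lt_succ_self).trans_le (h.1 ⟨_, rfl⟩))

/-- Members of components are lifted step by step along a cofinal `ω`-sequence, so no limit is met
before `i` itself. -/
theorem ExtensionProperty.of_isOmegaCofinal {i : Ordinal.{u}} (h : IsOmegaCofinal i) :
    ExtensionProperty κ i := by
  obtain ⟨f, hf, hlub⟩ := h
  intro a ha j hj b hb
  have hfi : ∀ n, f n < i := fun n => (hf n.lt_succ_self).trans_le (hlub.1 ⟨_, rfl⟩)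
  -- Starting the sequence at `j` makes `b` the first term of the lift.
  let g : ℕ → Ordinal.{u} := fun n => Nat.rec j (fun n _ => max j (f n)) n
  have hg0 : ∀ n, j ≤ g n := by
    rintro (_ | n)
    · exact le_rfl
    · exact le_max_left _ _
  have hg : Monotone g := by
    refine monotone_nat_of_le_succ ?_
    rintro (_ | n)
    · exact le_max_left _ _
    · exact max_le_max le_rfl (hf n.lt_succ_self).le
  have hgi : ∀ n, g n < i := by
    rintro (_ | n)
    · exact hj
    · exact max_lt hj (hfi n)
  have hlift : ∀ n (x : {x // x ∈ Raw.succEquiv (g n)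
      (Raw.conn i (succ (g n)) (succ_le_of_lt (hgi n)) a)}),
      ∃ y : {x // x ∈ Raw.succEquiv (g (n + 1))
        (Raw.conn i (succ (g (n + 1))) (succ_le_of_lt (hgi (n + 1))) a)},
        Raw.conn (g (n + 1)) (g n) (hg n.le_succ) y.1 = x.1 := by
    rintro n ⟨x, hx⟩
    obtain ⟨y, hy, e⟩ := (mem_component_iff ha (hg n.le_succ)
      (succ_le_of_lt (hgi (n + 1))) _).1 hx
    exact ⟨⟨y, hy⟩, e⟩
  choose F hF using hlift
  let s : ∀ n, {x // x ∈ Raw.succEquiv (g n)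
      (Raw.conn i (succ (g n)) (succ_le_of_lt (hgi n)) a)} :=
    fun n => Nat.rec ⟨b, hb⟩ (fun n x => F n x) n
  have hs : ∀ m n (h : m ≤ n), Raw.conn (g n) (g m) (hg h) (s n).1 = (s m).1 := by
    intro m n h
    induction n, h using Nat.le_induction with
    | base => exact Raw.conn_self _ _
    | succ n hmn ih =>
      rw [← ih, ← hF n (s n)]
      exact (Raw.conn_conn (mem_level_of_mem_component ha (F n (s n)).2) _ _).symm
  have hcof : ∀ k < i, ∃ n, k ≤ g n := fun k hk => by
    obtain ⟨_, ⟨n, rfl⟩, hn, -⟩ := hlub.exists_between hk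
    exact ⟨n + 1, hn.le.trans (le_max_right _ _)⟩
  obtain ⟨c, hc, h1, h2⟩ := exists_limitStep (isSuccPrelimit_of_isLUB_range hf hlub) ha g hg hgi
    hcof (fun n => (s n).1) (fun n => (s n).2) hs
  exact ⟨c, hc, h1, h2 0⟩

/-! ### The tree property -/

/-- The elements of the components of `a` that are compatible with `b`. -/
def Compatible {i j : Ordinal.{u}} (a : Raw i) (hj : j < i) (b : Raw j) (k : Set.Iio i) : Type _ :=
  -- The witness lives at the maximum of the two indices, so that one formula serves for `k` below
  -- and above `j`.
  {d : Raw k.1 // ∃ e ∈ Raw.succEquiv (max k.1 j)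
    (Raw.conn i (succ (max k.1 j)) (succ_le_of_lt (max_lt k.2 hj)) a),
      Raw.conn _ k.1 (le_max_left _ _) e = d ∧ Raw.conn _ j (le_max_right _ _) e = b}

instance {i j : Ordinal.{u}} (a : Raw i) (hj : j < i) (b : Raw j) (k : Set.Iio i) :
    Small.{u} (Compatible a hj b k) :=
  inferInstanceAs (Small.{u} (Subtype _))

theorem Compatible.mem {i j : Ordinal.{u}} {a : Raw i} (ha : a ∈ Raw.level κ i) {hj : j < i}
    {b : Raw j} {k : Set.Iio i} (d : Compatible a hj b k) :
    d.1 ∈ Raw.succEquiv k.1 (Raw.conn i (succ k.1) (succ_le_of_lt k.2) a) := by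
  obtain ⟨e, he, h1, -⟩ := d.2
  rw [mem_component_iff ha (le_max_left k.1 j) (succ_le_of_lt (max_lt k.2 hj))]
  exact ⟨e, he, h1⟩

/-- Restriction of elements of components that are compatible with `b`. -/
noncomputable def Compatible.restrict {i j : Ordinal.{u}} {a : Raw i} (ha : a ∈ Raw.level κ i) {hj : j < i}
    {b : Raw j} {k l : Set.Iio i} (hkl : k ≤ l) (d : Compatible a hj b l) : Compatible a hj b k :=
  ⟨Raw.conn l.1 k.1 hkl d.1, by
    obtain ⟨e, he, h1, h2⟩ := d.2
    have hm : max k.1 j ≤ max l.1 j := max_le_max hkl le_rfl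
    have hl := mem_level_of_mem_component ha he
    refine ⟨Raw.conn _ _ hm e, (mem_component_iff ha hm
      (succ_le_of_lt (max_lt l.2 hj)) _).2 ⟨e, he, rfl⟩, ?_, ?_⟩
    · rw [Raw.conn_conn hl, ← h1, Raw.conn_conn hl]
    · rw [Raw.conn_conn hl, ← h2]⟩

theorem Compatible.restrict_surjective {i j : Ordinal.{u}} {a : Raw i} (ha : a ∈ Raw.level κ i)
    {hj : j < i} {b : Raw j} {k l : Set.Iio i} (hkl : k ≤ l) :
    Function.Surjective (Compatible.restrict (hj := hj) (b := b) ha hkl) := by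
  rintro ⟨_, e, he, rfl, h2⟩
  have hm : max k.1 j ≤ max l.1 j := max_le_max hkl le_rfl
  obtain ⟨f, hf, h3⟩ := (mem_component_iff ha hm (succ_le_of_lt (max_lt l.2 hj)) _).1 he
  have hl := mem_level_of_mem_component ha hf
  refine ⟨⟨Raw.conn _ _ (le_max_left _ _) f, f, hf, rfl, ?_⟩, Subtype.ext ?_⟩
  · rw [← h2, ← h3, Raw.conn_conn hl]
  · subst h3
    exact (Raw.conn_conn hl _ _).trans (Raw.conn_conn hl _ _).symm

/-- The tree of elements of components that are compatible with `b`. -/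
noncomputable def compatibleTree {i j : Ordinal.{u}} {a : Raw i} (ha : a ∈ Raw.level κ i)
    (hj : j < i) (b : Raw j) : InverseChain.{u + 1, u} (Set.Iio i) where
  level k := Shrink.{u} (Compatible a hj b k)
  conn h d := equivShrink _ (Compatible.restrict ha h ((equivShrink _).symm d))
  conn_self k d := by
    rw [← Equiv.eq_symm_apply]
    exact Subtype.ext (Raw.conn_self _ _)
  conn_conn {k j i} hkj hji d := by
    rw [Equiv.symm_apply_apply]
    congr 1
    exact Subtype.ext (Raw.conn_conn
      (mem_level_of_mem_component ha (((equivShrink _).symm d).mem ha)) _ _)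

theorem compatibleTree_isTidy {i j : Ordinal.{u}} {a : Raw i} (ha : a ∈ Raw.level κ i)
    (hj : j < i) {b : Raw j}
    (hb : b ∈ Raw.succEquiv j (Raw.conn i (succ j) (succ_le_of_lt hj) a)) :
    (compatibleTree ha hj b).IsTidy where
  surjective k l h := (equivShrink _).surjective.comp
    ((Compatible.restrict_surjective ha h).comp (equivShrink _).symm.surjective)
  limit k hk x y h := by
    apply (equivShrink _).symm.injective
    refine Subtype.ext (Raw.ext_limit (i := k.1) ?_ fun l hl => ?_)
    -- `hk` says that `k` is a limit within `Set.Iio i`; this must be transferred to the ordinal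
    -- itself.
    · rw [isSuccPrelimit_iff_succ_lt]
      intro l hl
      refine lt_of_le_of_ne (succ_le_of_lt hl) fun e => hk ⟨l, hl.trans k.2⟩ ⟨hl, ?_⟩
      intro m hm hmk
      have h1 : succ l ≤ m.1 := succ_le_of_lt hm
      exact absurd hmk (not_lt.2 (show k.1 ≤ m.1 from e ▸ h1))
    · have := (equivShrink _).injective (h ⟨l, hl.trans k.2⟩ hl)
      exact congrArg Subtype.val this
  root := by
    refine ⟨⟨0, (zero_le).trans_lt hj⟩, fun k => zero_le (a := k.1), ?_⟩
    have hm : max 0 j ≤ j := max_le zero_le le_rfl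
    refine ⟨equivShrink _ ⟨_, Raw.conn j _ hm b, (mem_component_iff ha hm
      (succ_le_of_lt hj) _).2 ⟨b, hb, rfl⟩, rfl, ?_⟩⟩
    have hl := mem_level_of_mem_component ha hb
    rw [Raw.conn_conn hl, Raw.conn_self]

theorem SizeLT.mk_shrink_lt {c : Cardinal.{u}} {α : Type v} [Small.{u} α]
    (h : SizeLT (c : WithTop Cardinal.{u}) α) : #(Shrink.{u} α) < c := by
  have := h.of_surjective _ (equivShrink.{u} α).surjective c rfl
  rwa [Cardinal.lift_lt] at this

theorem sizeLT_of_mk_lt {c : Cardinal.{u}} {α : Type u} (h : #α < c) :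
    SizeLT (c : WithTop Cardinal.{u}) α := by
  intro c' hc
  obtain rfl := WithTop.coe_injective hc
  rwa [Cardinal.lift_lt]

theorem sizeLT_Iio {j : Ordinal.{u}} (hj : ¬ BoundLE κ j) : SizeLT κ (Set.Iio j) := by
  intro c hc
  have h : j.card < c := lt_ord.1 (not_le.1 fun h => hj ⟨c, hc, h⟩)
  rwa [Cardinal.mk_Iio_ordinal, Cardinal.lift_lift, Cardinal.lift_lt]

/-- A full branch of the tree of members compatible with `b` defines a successor of `a`, and
compatibility forces its `j`th coordinate to be `b`. The size of the components comes either from `κ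
= c` or from strong inaccessibility. -/
theorem ExtensionProperty.of_treeProperty {c : Cardinal.{u}} (hc : IsSuccPrelimit c.ord)
    (ht : TreeProperty c)
    (hsize : ∀ a ∈ Raw.level κ c.ord, ∀ (j : Ordinal.{u}) (hj : j < c.ord),
      SizeLT c (Raw.succEquiv j (Raw.conn c.ord (succ j) (succ_le_of_lt hj) a))) :
    ExtensionProperty κ c.ord := by
  intro a ha j hj b hb
  obtain ⟨x, hx⟩ := ht (compatibleTree ha hj b) (compatibleTree_isTidy ha hj hb) fun k => by
    refine SizeLT.mk_shrink_lt ((hsize a ha k.1 k.2).of_injective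
      (fun d => ⟨d.1, d.mem ha⟩) fun d e h => ?_)
    exact Subtype.ext (Subtype.mk.inj h)
  let s : ∀ k, Compatible a hj b k := fun k => (equivShrink _).symm (x k)
  have hs : ∀ k l (h : k ≤ l), Raw.conn l.1 k.1 h (s l).1 = (s k).1 := fun k l h => by
    have h1 : (s l).restrict ha h = s k := by
      exact (Equiv.eq_symm_apply _).2 (hx k l h)
    exact congrArg Subtype.val h1
  obtain ⟨d, hd, h1, h2⟩ := exists_limitStep hc ha (fun k : Set.Iio c.ord => k.1)
    (fun _ _ h => h) (fun k => k.2) (fun k hk => ⟨⟨k, hk⟩, le_rfl⟩) (fun k => (s k).1)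
    (fun k => (s k).mem ha) hs
  refine ⟨d, hd, h1, (h2 ⟨j, hj⟩).trans ?_⟩
  obtain ⟨e, he, h3, h4⟩ := (s ⟨j, hj⟩).2
  rw [← h3, ← h4]

/-- Successor levels are power sets. A tuple at a limit is determined by its graph, a subset of the
disjoint union of the earlier levels, which is small by regularity. -/
theorem sizeLT_raw {c : Cardinal.{u}} (hc : StronglyInaccessible c) (j : Ordinal.{u})
    (hj : j < c.ord) : SizeLT c (Raw j) := by
  induction j using SuccOrder.prelimitRecOn with
  | succ j _ ih =>
    have h := sizeLT_of_mk_lt (hc.2 _ (ih ((lt_succ j).trans hj)).mk_shrink_lt)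
    exact h.of_surjective _ ((Equiv.Set.congr (equivShrink.{u} (Raw j)).symm).trans
      (Raw.succEquiv j).symm).surjective
  | isSuccPrelimit j hl ih =>
    let A : Shrink.{u} (Set.Iio j) → Type u := fun k =>
      Shrink.{u} (Raw ((equivShrink _).symm k).1)
    have hA : #(Σ k, A k) < c := by
      rw [mk_sigma]
      refine sum_lt_of_isRegular hc.1 ?_ fun k => ?_
      · exact (sizeLT_Iio fun ⟨c', h, h'⟩ => hj.not_ge
          (WithTop.coe_injective h ▸ h')).mk_shrink_lt
      · have hk := ((equivShrink (Set.Iio j)).symm k).2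
        exact (ih _ hk (hk.trans hj)).mk_shrink_lt
    refine (sizeLT_of_mk_lt (hc.2 _ hA)).of_injective (fun x => {p | p.2 = equivShrink _
      (Raw.limitEquiv hl x ((equivShrink _).symm p.1))}) fun x y h => ?_
    apply (Raw.limitEquiv hl).injective
    funext k
    have h1 := Set.ext_iff.1 h ⟨equivShrink _ k, equivShrink _
      (Raw.limitEquiv hl x ((equivShrink _).symm (equivShrink _ k)))⟩
    have h2 := (equivShrink _).injective (h1.1 rfl)
    have h3 : ∀ m, m = k → Raw.limitEquiv hl x m = Raw.limitEquiv hl y m →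
      Raw.limitEquiv hl x k = Raw.limitEquiv hl y k := by
      rintro m rfl h
      exact h
    exact h3 _ (Equiv.symm_apply_apply _ _) h2

theorem ExtensionProperty.of_weaklyCompact {c : Cardinal.{u}} (hc : WeaklyCompact c) :
    ExtensionProperty κ c.ord := by
  refine .of_treeProperty (isSuccLimit_ord hc.1.1.aleph0_le).isSuccPrelimit hc.2
    fun a _ j hj => ?_
  exact (sizeLT_raw hc.1 j hj).of_injective _ Subtype.val_injective

theorem ExtensionProperty.of_bound {c : Cardinal.{u}} (hc : c.IsRegular) (ht : TreeProperty c) :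
    ExtensionProperty (c : WithTop Cardinal.{u}) c.ord := by
  refine .of_treeProperty (isSuccLimit_ord hc.aleph0_le).isSuccPrelimit ht
    fun a ha j hj => ?_
  exact (Raw.mem_level_succ.1 (Raw.conn_mem ha (succ_le_of_lt hj))).1

end GhostChain

/-! ### Rigidity of the levels at and above `κ` -/

namespace GhostChain

/-! ### Levels above the bound -/

section Bound

variable {c : Cardinal.{u}}

theorem exists_forall_lt_of_sizeLT (hc : c.IsRegular) {α : Type v} (h : SizeLT c α)
    (f : α → Ordinal.{u}) (hf : ∀ x, f x < c.ord) : ∃ k < c.ord, ∀ x, f x ≤ k := by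
  refine ⟨⨆ x, f x, Ordinal.lift_iSup_lt_of_lt_cof ?_ hf, fun x =>
    le_ciSup (f := f) ⟨c.ord, by rintro _ ⟨y, rfl⟩; exact (hf y).le⟩ x⟩
  rw [← Ordinal.lift_cof, hc.cof_ord]
  exact h c rfl

/-- Otherwise each of the fewer than `c` elements of `a` differs from `d` at some index below
`c.ord`, and by regularity all of them do at a common `k < c.ord`. But at `k` some element of `a`
agrees with `d`. -/
theorem mem_of_forall_mem_component_ord (hc : c.IsRegular) {a : Raw (succ c.ord)}
    (ha : a ∈ Raw.level c (succ c.ord)) {d : Raw c.ord} (hd : d ∈ Raw.level ⊤ c.ord)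
    (h : ∀ (k : Ordinal.{u}) (hk : k < c.ord), Raw.conn _ k hk.le d ∈
      Raw.succEquiv k (Raw.conn _ (succ k) (succ_le_succ hk.le) a)) :
    d ∈ Raw.succEquiv c.ord a := by
  have hl := (isSuccLimit_ord hc.aleph0_le).isSuccPrelimit
  by_contra hda
  have h1 : ∀ b : Raw.succEquiv c.ord a, ∃ (k : Ordinal.{u}) (hk : k < c.ord),
      Raw.conn _ k hk.le b.1 ≠ Raw.conn _ k hk.le d := by
    rintro ⟨b, hb⟩
    by_contra! h2
    exact hda (Raw.ext_limit hl h2 ▸ hb)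
  choose f hf hfd using h1
  obtain ⟨k, hk, hfk⟩ := exists_forall_lt_of_sizeLT hc (Raw.mem_level_succ.1 ha).1 f hf
  obtain ⟨b, hb, e⟩ := (Raw.mem_conn_succ hk.le _).1 (h k hk)
  apply hfd ⟨b, hb⟩
  rw [← Raw.conn_conn (Raw.mem_level_of_mem ha hb) hk.le (hfk ⟨b, hb⟩), e, Raw.conn_conn hd]

/-- Induction on `i`. For `x ∈ a`, closedness puts the restriction of `x` to `c.ord` among the
restrictions of elements of `b`; an element of `b` with that restriction equals `x` by the induction
hypothesis. -/
theorem conn_injective (hc : c.IsRegular) {i : Ordinal.{u}} (hi : c.ord ≤ i) {a b : Raw i}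
    (ha : a ∈ Raw.level c i) (hb : b ∈ Raw.level c i)
    (h : Raw.conn i c.ord hi a = Raw.conn i c.ord hi b) : a = b := by
  have hl := (isSuccLimit_ord hc.aleph0_le).isSuccPrelimit
  induction i using SuccOrder.prelimitRecOn with
  | isSuccPrelimit i hil ih =>
    rcases hi.lt_or_eq with hlt | rfl
    · refine Raw.ext_limit hil fun k hk => ?_
      rcases le_total c.ord k with h1 | h1
      · refine ih k hk h1 (Raw.conn_mem ha _) (Raw.conn_mem hb _) ?_
        rw [Raw.conn_conn ha, Raw.conn_conn hb, h]
      · rw [← Raw.conn_conn ha hi h1, h, Raw.conn_conn hb]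
    · rwa [Raw.conn_self, Raw.conn_self] at h
  | succ i _ ih =>
    have hi' : c.ord ≤ i := lt_succ_iff.1 (lt_of_le_of_ne hi fun e => hl.succ_ne i e.symm)
    have key : ∀ a b : Raw (succ i), a ∈ Raw.level c (succ i) → b ∈ Raw.level c (succ i) →
        Raw.conn (succ i) c.ord hi a = Raw.conn (succ i) c.ord hi b →
        ∀ x ∈ Raw.succEquiv i a, x ∈ Raw.succEquiv i b := by
      intro a b ha hb h x hx
      have hx' := Raw.mem_level_of_mem ha hx
      have h1 : Raw.conn i c.ord hi' x ∈ Raw.succEquiv c.ord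
          (Raw.conn (succ i) (succ c.ord) (succ_le_succ hi') b) := by
        refine mem_of_forall_mem_component_ord hc (Raw.conn_mem hb _)
          (Raw.level_subset_top _ (Raw.conn_mem hx' _)) fun k hk => ?_
        rw [Raw.conn_conn hb, ← Raw.conn_conn hb hi (succ_le_of_lt hk), ← h, Raw.conn_conn ha,
          Raw.conn_conn hx', Raw.mem_conn_succ (hk.le.trans hi')]
        exact ⟨x, hx, rfl⟩
      obtain ⟨y, hy, e⟩ := (Raw.mem_conn_succ hi' _).1 h1
      rwa [← ih hi' (Raw.mem_level_of_mem hb hy) hx' e]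
    exact Raw.ext_succ fun x => ⟨key a b ha hb h x, key b a hb ha h.symm x⟩

theorem mem_of_forall_mem_component (hc : c.IsRegular) {j : Ordinal.{u}} (hj : IsSuccPrelimit j)
    (hcj : c.ord ≤ j) {a : Raw (succ j)} (ha : a ∈ Raw.level c (succ j)) {d : Raw j}
    (hd : d ∈ Raw.level ⊤ j)
    (h : ∀ (k : Ordinal.{u}) (hk : k < j), Raw.conn _ k hk.le d ∈
      Raw.succEquiv k (Raw.conn _ (succ k) (succ_le_succ hk.le) a)) :
    d ∈ Raw.succEquiv j a := by
  have hd' : d ∈ Raw.level c j := by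
    refine (Raw.mem_level_limit hj).2 ⟨fun k => ?_, ((Raw.mem_level_limit hj).1 hd).2⟩
    have := h k.1 k.2
    rw [Raw.conn_limit hj k.2] at this
    exact Raw.mem_level_of_mem (Raw.conn_mem ha _) this
  have h1 : Raw.conn j c.ord hcj d ∈ Raw.succEquiv c.ord
      (Raw.conn (succ j) (succ c.ord) (succ_le_succ hcj) a) := by
    refine mem_of_forall_mem_component_ord hc (Raw.conn_mem ha _) (Raw.conn_mem hd _)
      fun k hk => ?_
    rw [Raw.conn_conn ha, Raw.conn_conn hd]
    exact h k (hk.trans_le hcj)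
  obtain ⟨b, hb, e⟩ := (Raw.mem_conn_succ hcj _).1 h1
  rwa [← conn_injective hc hcj (Raw.mem_level_of_mem ha hb) hd' e]

/-- From index `max c.ord j` on, restrictions are injective, so lifts are unique and therefore
compatible. At `i = c.ord` there is no such index below `i`, and the tree property has to help. -/
theorem ExtensionProperty.of_large (hc : c.IsRegular) {i : Ordinal.{u}} (hi : IsSuccPrelimit i)
    (hci : c.ord < i) : ExtensionProperty (c : WithTop Cardinal.{u}) i := by
  intro a ha j hj b hb
  have hm : max c.ord j < i := max_lt hci hj
  obtain ⟨b₀, hb₀, rfl⟩ := (mem_component_iff ha (le_max_right c.ord j)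
    (succ_le_of_lt hm) _).1 hb
  have hb₀l := mem_level_of_mem_component ha hb₀
  have h1 : ∀ k : Set.Ico (max c.ord j) i, ∃ d ∈ Raw.succEquiv k.1
      (Raw.conn i (succ k.1) (succ_le_of_lt k.2.2) a), Raw.conn _ _ k.2.1 d = b₀ := fun k =>
    (mem_component_iff ha k.2.1 (succ_le_of_lt k.2.2) _).1 hb₀
  choose s hs hsb using h1
  have hsl := fun k => mem_level_of_mem_component ha (hs k)
  obtain ⟨d, hd, h2, h3⟩ := exists_limitStep hi ha (fun k : Set.Ico (max c.ord j) i => k.1)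
    (fun _ _ h => h) (fun k => k.2.2)
    (fun k hk => ⟨⟨max (max c.ord j) k, le_max_left _ _, max_lt hm hk⟩, le_max_right _ _⟩) s hs
    (fun k l h => by
      have hck : c.ord ≤ k.1 := (le_max_left _ _).trans k.2.1
      refine conn_injective hc hck (Raw.conn_mem (hsl l) _) (hsl k) ?_
      rw [← Raw.conn_conn (hsl k) k.2.1 (le_max_left _ _), hsb, Raw.conn_conn (hsl l),
        ← Raw.conn_conn (hsl l) l.2.1 (le_max_left _ _), hsb])
  refine ⟨d, hd, h2, ?_⟩
  have := h3 ⟨max c.ord j, le_rfl, hm⟩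
  rw [← Raw.conn_conn hd hm.le (le_max_right _ _), this,
    ← hsb ⟨max c.ord j, le_rfl, hm⟩, Raw.conn_self]

end Bound

theorem Extensible.extensionProperty {κ : WithTop Cardinal.{u}} (hκ : BoundRegular κ)
    {i : Ordinal.{u}} (h : Extensible κ i) : ExtensionProperty κ i := by
  cases h with
  | zero => exact extensionProperty_zero
  | omegaCofinal _ h => exact .of_isOmegaCofinal h
  | weaklyCompact c h => exact .of_weaklyCompact h
  | large c _ hc hi hci =>
    subst hc
    exact .of_large (hκ c rfl) hi
      (((lt_add_iff_pos_right _).2 omega0_pos).trans_le hci)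
  | bound c hc ht =>
    subst hc
    exact .of_bound (hκ c rfl) ht

/-! ### Bisimilarity above the bound -/

section Bisimilarity

variable {c : Cardinal.{u}}

/-- The components of index at least `c.ord` consist of the restrictions of the successors. -/
theorem mem_component_iff_exists_step (hc : c.IsRegular) {i : Ordinal.{u}} {a : Raw i}
    (ha : a ∈ Raw.level c i) {k : Ordinal.{u}} (hck : c.ord ≤ k) (hk : succ k ≤ i) {d : Raw k} :
    d ∈ Raw.succEquiv k (Raw.conn i (succ k) hk a) ↔
      ∃ (l : Ordinal.{u}) (hkl : k ≤ l) (b : Raw l) (hb : b ∈ Raw.level c l),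
        Step (node a (Raw.level_subset_top i ha)) (node b (Raw.level_subset_top l hb)) ∧
          Raw.conn l k hkl b = d := by
  induction i using SuccOrder.prelimitRecOn with
  | isSuccPrelimit i hi _ =>
    have hki := succ_le_iff.1 hk
    constructor
    · intro h
      obtain ⟨b, hb, hab, e⟩ := ExtensionProperty.of_large hc hi (hck.trans_lt hki) a ha k hki d h
      exact ⟨i, hki.le, b, hb, (step_limit_iff hi).2 ⟨b, _, hab, rfl⟩, e⟩
    · rintro ⟨l, hkl, b, hb, h, rfl⟩
      obtain ⟨b', hb', hab, e⟩ := (step_limit_iff hi).1 h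
      obtain ⟨rfl, e⟩ := Sigma.mk.inj e
      obtain rfl : b = b' := congrArg Subtype.val (eq_of_heq e)
      exact hab k hki
  | succ i _ _ =>
    have hki := succ_le_succ_iff.1 hk
    rw [Raw.mem_conn_succ hki]
    constructor
    · rintro ⟨b, hb, e⟩
      exact ⟨i, hki, b, Raw.mem_level_of_mem ha hb, step_succ_iff.2 ⟨b, hb, rfl⟩, e⟩
    · rintro ⟨l, hkl, b, hb, h, rfl⟩
      obtain ⟨b', hb', e⟩ := step_succ_iff.1 h
      obtain ⟨rfl, e⟩ := Sigma.mk.inj e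
      obtain rfl : b = b' := congrArg Subtype.val (eq_of_heq e)
      exact ⟨b, hb', rfl⟩

theorem limitStep_conn_iff (hc : c.IsRegular) {i j : Ordinal.{u}} {a : Raw i}
    (ha : a ∈ Raw.level c i) (hj : IsSuccPrelimit j) (hcj : c.ord ≤ j) (hji : j ≤ i)
    (hji' : succ j ≤ i) {d : Raw j} (hd : d ∈ Raw.level ⊤ j) :
    LimitStep (Raw.conn i j hji a) d ↔
      d ∈ Raw.succEquiv j (Raw.conn i (succ j) hji' a) := by
  constructor
  · intro h
    refine mem_of_forall_mem_component hc hj hcj (Raw.conn_mem ha _) hd fun k hk => ?_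
    have := h k hk
    rwa [Raw.conn_conn ha] at this ⊢
  · intro h k hk
    rw [Raw.conn_conn ha, ← Raw.conn_conn ha hji' (succ_le_succ hk.le),
      Raw.mem_conn_succ hk.le]
    exact ⟨d, h, rfl⟩

/-- Restriction to a level `≥ c.ord` is a bisimulation: the successors of the restricted element are
exactly the restrictions of the successors of `a`. The claim follows by induction on the stage. -/
theorem proj_step_conn_eq (hc : c.IsRegular) (m : Ordinal.{u}) : ∀ {i j : Ordinal.{u}}
    {a : Raw i} (ha : a ∈ Raw.level c i) (_ : c.ord ≤ j) (hji : j ≤ i),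
    Raw.proj Step m (node (Raw.conn i j hji a) (Raw.level_subset_top j (Raw.conn_mem ha hji))) =
      Raw.proj Step m (node a (Raw.level_subset_top i ha)) := by
  have hl := (isSuccLimit_ord hc.aleph0_le).isSuccPrelimit
  induction m using SuccOrder.prelimitRecOn with
  | isSuccPrelimit m hm ih =>
    intro i j a ha hcj hji
    exact (Raw.proj_limit_eq_iff hm).2 fun k hk => ih k hk ha hcj hji
  | succ m _ ih =>
    intro i j a ha hcj hji
    rcases hji.eq_or_lt with rfl | hlt
    · simp only [Raw.conn_self]
    -- `k` is the level where the successors of the restriction live: `j` if `j` is a limit, else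
    -- its predecessor, which is still `≥ c.ord` because `c.ord` is a limit.
    have key : ∃ (k : Ordinal.{u}) (hck : c.ord ≤ k) (hk : succ k ≤ i), ∀ n,
        Step (node (Raw.conn i j hji a) (Raw.level_subset_top j (Raw.conn_mem ha hji))) n ↔
          ∃ (d : Raw k) (hd : d ∈ Raw.level ⊤ k), n = node d hd ∧
            d ∈ Raw.succEquiv k (Raw.conn i (succ k) hk a) := by
      induction j using SuccOrder.prelimitRecOn with
      | isSuccPrelimit j hj _ =>
        refine ⟨j, hcj, succ_le_of_lt hlt, fun n => ?_⟩
        rw [step_limit_iff hj]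
        constructor
        · rintro ⟨d, hd, h, rfl⟩
          exact ⟨d, hd, rfl, (limitStep_conn_iff hc ha hj hcj hji _ hd).1 h⟩
        · rintro ⟨d, hd, rfl, h⟩
          exact ⟨d, hd, (limitStep_conn_iff hc ha hj hcj hji _ hd).2 h, rfl⟩
      | succ j _ _ =>
        refine ⟨j, lt_succ_iff.1 (lt_of_le_of_ne hcj fun e => hl.succ_ne j e.symm), hji,
          fun n => ?_⟩
        rw [step_succ_iff]
        constructor
        · rintro ⟨d, hd, rfl⟩
          exact ⟨d, _, rfl, hd⟩
        · rintro ⟨d, hd, rfl, h⟩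
          exact ⟨d, h, rfl⟩
    obtain ⟨k, hck, hk, key⟩ := key
    rw [Raw.proj_succ_eq_iff]
    constructor
    · intro n hn
      obtain ⟨d, hd, rfl, h⟩ := (key n).1 hn
      obtain ⟨l, hkl, b, hb, hab, rfl⟩ := (mem_component_iff_exists_step hc ha hck hk).1 h
      exact ⟨_, hab, ih hb hck hkl⟩
    · intro n hn
      have h1 : ∃ (l : Ordinal.{u}) (_ : k ≤ l) (b : Raw l) (hb : b ∈ Raw.level c l),
          n = node b (Raw.level_subset_top l hb) := by
        clear key ih
        induction i using SuccOrder.prelimitRecOn with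
        | isSuccPrelimit i hi _ =>
          obtain ⟨b, hb, hab, rfl⟩ := (step_limit_iff hi).1 hn
          exact ⟨i, (le_succ k).trans hk, b, mem_level_of_limitStep hi ha hb hab, rfl⟩
        | succ i _ _ =>
          obtain ⟨b, hb, rfl⟩ := step_succ_iff.1 hn
          exact ⟨i, succ_le_succ_iff.1 hk, b, Raw.mem_level_of_mem ha hb, rfl⟩
      obtain ⟨l, hkl, b, hb, rfl⟩ := h1
      exact ⟨_, (key _).2 ⟨_, Raw.level_subset_top k (Raw.conn_mem hb hkl), rfl,
        (mem_component_iff_exists_step hc ha hck hk).2 ⟨l, hkl, b, hb, hn, rfl⟩⟩, ih hb hck hkl⟩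

theorem proj_step_proj_eq (hc : c.IsRegular) {X : Type v} {r : X → X → Prop} (m : Ordinal.{u}) :
    ∀ {j : Ordinal.{u}} {x : X} (_ : IsBranching c r x) (_ : c.ord ≤ j),
    Raw.proj Step m (node (Raw.proj r j x) (Raw.proj_mem_top r j x)) = Raw.proj r m x := by
  have hl := (isSuccLimit_ord hc.aleph0_le).isSuccPrelimit
  induction m using SuccOrder.prelimitRecOn with
  | isSuccPrelimit m hm ih =>
    intro j x hx hcj
    exact (Raw.proj_limit_eq_iff hm).2 fun k hk => ih k hk hx hcj
  | succ m _ ih =>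
    intro j x hx hcj
    have key : ∃ (k : Ordinal.{u}) (_ : c.ord ≤ k), ∀ n,
        Step (node (Raw.proj r j x) (Raw.proj_mem_top r j x)) n ↔
          ∃ y, r x y ∧ n = node (Raw.proj r k y) (Raw.proj_mem_top r k y) := by
      induction j using SuccOrder.prelimitRecOn with
      | isSuccPrelimit j hj _ =>
        refine ⟨j, hcj, fun n => ?_⟩
        rw [step_limit_iff hj]
        -- Viewed as the restriction of `p_{j+1} x`, the element `p_j x` falls under the closedness
        -- criterion `limitStep_conn_iff`.
        have e := Raw.conn_proj r (succ j) x j (le_succ j)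
        have hx' := Raw.proj_mem_level r (succ j) x hx
        constructor
        · rintro ⟨d, hd, h, rfl⟩
          rw [← e, limitStep_conn_iff hc hx' hj hcj _ le_rfl hd, Raw.conn_self,
            Raw.mem_proj_succ] at h
          obtain ⟨y, hy, rfl⟩ := h
          exact ⟨y, hy, rfl⟩
        · rintro ⟨y, hy, rfl⟩
          refine ⟨_, _, ?_, rfl⟩
          rw [← e, limitStep_conn_iff hc hx' hj hcj _ le_rfl (Raw.proj_mem_top r j y),
            Raw.conn_self, Raw.mem_proj_succ]
          exact ⟨y, hy, rfl⟩
      | succ j _ _ =>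
        refine ⟨j, lt_succ_iff.1 (lt_of_le_of_ne hcj fun e => hl.succ_ne j e.symm), fun n => ?_⟩
        rw [step_succ_iff]
        constructor
        · rintro ⟨d, hd, rfl⟩
          obtain ⟨y, hy, rfl⟩ := Raw.mem_proj_succ.1 hd
          exact ⟨y, hy, rfl⟩
        · rintro ⟨y, hy, rfl⟩
          exact ⟨_, Raw.mem_proj_succ.2 ⟨y, hy, rfl⟩, rfl⟩
    obtain ⟨k, hck, key⟩ := key
    have hx' : ∀ y, r x y → IsBranching c r y := fun y hy z hz => hx z (.head hy hz)
    rw [Raw.proj_succ_eq_iff]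
    constructor
    · intro n hn
      obtain ⟨y, hy, rfl⟩ := (key n).1 hn
      exact ⟨y, hy, ih (hx' y hy) hck⟩
    · intro y hy
      exact ⟨_, (key _).2 ⟨y, hy, rfl⟩, ih (hx' y hy) hck⟩

end Bisimilarity

end GhostChain

/-! ### From a tree without full branches to an element without successors -/

namespace GhostChain

/-! ### More on sizes -/

theorem BoundRegular.sizeLT_of_finite {κ : WithTop Cardinal.{u}} (hκ : BoundRegular κ)
    (α : Type v) [Finite α] : SizeLT κ α := fun c hc =>
  (Cardinal.lift_lt_aleph0.2 (Cardinal.lt_aleph0_of_finite α)).trans_le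
    (Cardinal.aleph0_le_lift.2 (hκ c hc).aleph0_le)

theorem SizeLT.prod {κ : WithTop Cardinal.{u}} (hκ : BoundRegular κ) {α : Type v} {β : Type v}
    (hα : SizeLT κ α) (hβ : SizeLT κ β) : SizeLT κ (α × β) := fun c hc => by
  rw [Cardinal.mk_prod, Cardinal.lift_id, Cardinal.lift_id, Cardinal.lift_mul]
  exact Cardinal.mul_lt_of_lt (Cardinal.aleph0_le_lift.2 (hκ c hc).aleph0_le) (hα c hc) (hβ c hc)

theorem isBranching_of_invariant {κ : WithTop Cardinal.{u}} {X : Type v} {r : X → X → Prop}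
    (P : X → Prop) (hP : ∀ x, P x → SizeLT κ {y // r x y} ∧ ∀ y, r x y → P y) {x : X}
    (hx : P x) : IsBranching κ r x := by
  intro y hy
  refine (hP y ?_).1
  induction hy with
  | refl => exact hx
  | tail _ h ih => exact (hP _ ih).2 _ h

/-! ### Trees of sets of pairs of ordinals -/

/-- The pairs of ordinals below `l`. -/
def box (l : Ordinal.{u}) : Set (Ordinal.{u} × Ordinal.{u}) := {p | p.1 < l ∧ p.2 < l}

/-- A tree of height `i`, with nonempty `< κ`-sized levels, without full branches, and in which
every element extends to all levels. The elements of the `l`th level are sets of pairs of ordinals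
below `l`, and restriction is intersection. -/
structure BranchlessTree (κ : WithTop Cardinal.{u}) (i : Ordinal.{u}) where
  level : Ordinal.{u} → Set (Set (Ordinal.{u} × Ordinal.{u}))
  nonempty : ∀ l < i, (level l).Nonempty
  size : ∀ l < i, SizeLT κ (level l)
  restrict : ∀ k l, k ≤ l → l < i → ∀ S, S ∈ level k ↔ ∃ S' ∈ level l, S' ∩ box k = S
  no_branch : ∀ S, ¬ ∀ l < i, S ∩ box l ∈ level l

/-! ### A transition system coding a tree -/

/-- The states of the transition system that codes a tree. -/
inductive TreeState : Type (u + 1)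
  | ord (a : Ordinal.{u})
  | tag (a : Ordinal.{u})
  | pair (a b : Ordinal.{u})
  | elem (l : Ordinal.{u}) (S : Set (Ordinal.{u} × Ordinal.{u}))
  | family (l : Ordinal.{u})
  | root

namespace TreeState

/-- The successors of a state. -/
def succs (F : Ordinal.{u} → Set (Set (Ordinal.{u} × Ordinal.{u}))) (i : Ordinal.{u}) :
    TreeState.{u} → Set TreeState.{u}
  | ord a => {x | ∃ b < a, x = ord b}
  -- The `succ` separates tags from ordinals: the only successor of a tag has a transition, whereas
  -- a nonzero ordinal also has the successor `0`.
  | tag a => {ord (succ a)}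
  | pair a b => {ord a, tag b}
  -- The coordinate `l` stands for all ordinals `≥ l`, which stage `l` cannot distinguish. Pairs
  -- with such a coordinate are always present, so only the part of `S` in `box l` is recorded.
  | elem l S => {x | ∃ a ≤ l, ∃ b ≤ l, (a < l → b < l → (a, b) ∈ S) ∧ x = pair a b}
  | family l => {x | ∃ S ∈ F l, x = elem l S}
  | root => {x | ∃ l < i, x = family l}

/-- The transition relation. -/
def Rel (F : Ordinal.{u} → Set (Set (Ordinal.{u} × Ordinal.{u}))) (i : Ordinal.{u})
    (x y : TreeState.{u}) : Prop := y ∈ succs F i x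

variable {F : Ordinal.{u} → Set (Set (Ordinal.{u} × Ordinal.{u}))} {i : Ordinal.{u}}

theorem rel_ord {a : Ordinal.{u}} {y : TreeState.{u}} :
    Rel F i (ord a) y ↔ ∃ b < a, y = ord b := Iff.rfl

theorem rel_elem {l : Ordinal.{u}} {S : Set (Ordinal.{u} × Ordinal.{u})} {y : TreeState.{u}} :
    Rel F i (elem l S) y ↔
      ∃ a ≤ l, ∃ b ≤ l, (a < l → b < l → (a, b) ∈ S) ∧ y = pair a b := Iff.rfl

local notation "π" => Raw.proj (Rel F i)

/-! #### Ordinals -/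

theorem proj_ord_eq {l a b : Ordinal.{u}} (ha : l ≤ a) (hb : l ≤ b) :
    π l (ord a) = π l (ord b) := by
  induction l using SuccOrder.prelimitRecOn generalizing a b with
  | isSuccPrelimit l hl ih =>
    exact (Raw.proj_limit_eq_iff hl).2 fun k hk => ih k hk (hk.le.trans ha) (hk.le.trans hb)
  | succ l _ ih =>
    have key : ∀ {a b : Ordinal.{u}}, succ l ≤ a → succ l ≤ b → ∀ x', Rel F i (ord a) x' →
        ∃ y', Rel F i (ord b) y' ∧ π l x' = π l y' := by
      intro a b ha hb x' hx'
      obtain ⟨c, hc, rfl⟩ := rel_ord.1 hx'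
      rcases lt_or_ge c b with h | h
      · exact ⟨_, rel_ord.2 ⟨c, h, rfl⟩, rfl⟩
      · have hlb := succ_le_iff.1 hb
        exact ⟨_, rel_ord.2 ⟨l, hlb, rfl⟩, ih (hlb.le.trans h) le_rfl⟩
    refine Raw.proj_succ_eq_iff.2 ⟨key ha hb, fun y' hy' => ?_⟩
    obtain ⟨x', h1, h2⟩ := key hb ha y' hy'
    exact ⟨x', h1, h2.symm⟩

/-- The transition of `b` to `a` would be matched by some `c < a`, and `c` and `a` already differ at
stage `c + 1 ≤ a`. -/
theorem proj_ord_ne {a b : Ordinal.{u}} (h : a < b) : π (succ a) (ord a) ≠ π (succ a) (ord b) := by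
  induction a using WellFoundedLT.induction generalizing b with
  | ind a ih =>
    intro e
    obtain ⟨x, hx, hx'⟩ := (Raw.proj_succ_eq_iff.1 e).2 _ (rel_ord.2 ⟨a, h, rfl⟩)
    obtain ⟨c, hc, rfl⟩ := rel_ord.1 hx
    exact ih c hc hc (Raw.proj_eq_of_le (succ_le_of_lt hc) hx')

theorem ord_inj {l a b : Ordinal.{u}} (ha : a < l) (h : π l (ord a) = π l (ord b)) : a = b := by
  rcases lt_trichotomy a b with h1 | h1 | h1
  · exact (proj_ord_ne h1 (Raw.proj_eq_of_le (succ_le_of_lt ha) h)).elim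
  · exact h1
  · exact (proj_ord_ne h1 (Raw.proj_eq_of_le (succ_le_of_lt (h1.trans ha)) h).symm).elim

/-! #### Pairs -/

theorem proj_tag_eq {l a b : Ordinal.{u}} (ha : l ≤ a) (hb : l ≤ b) :
    π l (tag a) = π l (tag b) := by
  refine Raw.proj_eq_of_le (le_succ l) (Raw.proj_succ_eq_iff.2 ⟨?_, ?_⟩)
  · rintro _ rfl
    exact ⟨_, rfl, proj_ord_eq (ha.trans (le_succ a)) (hb.trans (le_succ b))⟩
  · rintro _ rfl
    exact ⟨_, rfl, proj_ord_eq (ha.trans (le_succ a)) (hb.trans (le_succ b))⟩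

theorem tag_inj {l a b : Ordinal.{u}} (ha : a < l)
    (h : π (succ (succ l)) (tag a) = π (succ (succ l)) (tag b)) : a = b := by
  obtain ⟨_, rfl, e⟩ := (Raw.proj_succ_eq_iff.1 h).1 _ rfl
  exact succ_injective (ord_inj (succ_lt_succ ha) e)

theorem proj_tag_ne_ord {l a b : Ordinal.{u}} :
    π (succ (succ l)) (tag a) ≠ π (succ (succ l)) (ord b) := by
  intro e
  have e1 := Raw.proj_succ_eq_iff.1 e
  obtain ⟨y, hy, -⟩ := e1.1 _ rfl
  obtain ⟨c, hc, rfl⟩ := rel_ord.1 hy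
  obtain ⟨_, rfl, e2⟩ := e1.2 _ (rel_ord.2 ⟨0, zero_le.trans_lt hc, rfl⟩)
  obtain ⟨y, hy, -⟩ := (Raw.proj_succ_eq_iff.1 e2).1 _ (rel_ord.2 ⟨a, lt_succ a, rfl⟩)
  obtain ⟨c, hc, rfl⟩ := rel_ord.1 hy
  exact not_lt_bot hc

theorem proj_pair_eq {l a b a' b' : Ordinal.{u}} (ha : a = a' ∨ l ≤ a ∧ l ≤ a')
    (hb : b = b' ∨ l ≤ b ∧ l ≤ b') : π l (pair a b) = π l (pair a' b') := by
  have h1 : π l (ord a) = π l (ord a') := by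
    rcases ha with rfl | ⟨h, h'⟩
    · rfl
    · exact proj_ord_eq h h'
  have h2 : π l (tag b) = π l (tag b') := by
    rcases hb with rfl | ⟨h, h'⟩
    · rfl
    · exact proj_tag_eq h h'
  refine Raw.proj_eq_of_le (le_succ l) (Raw.proj_succ_eq_iff.2 ⟨?_, ?_⟩)
  · rintro _ (rfl | rfl)
    · exact ⟨_, .inl rfl, h1⟩
    · exact ⟨_, .inr rfl, h2⟩
  · rintro _ (rfl | rfl)
    · exact ⟨_, .inl rfl, h1⟩
    · exact ⟨_, .inr rfl, h2⟩

theorem pair_inj {l a b a' b' : Ordinal.{u}} (ha : a < l) (hb : b < l)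
    (h : π (succ (succ (succ l))) (pair a b) = π (succ (succ (succ l))) (pair a' b')) :
    a = a' ∧ b = b' := by
  have h1 := (Raw.proj_succ_eq_iff.1 h).1
  constructor
  · obtain ⟨_, rfl | rfl, e⟩ := h1 _ (.inl rfl)
    · exact ord_inj (ha.trans_le ((le_succ l).trans (le_succ _))) e
    · exact (proj_tag_ne_ord e.symm).elim
  · obtain ⟨_, rfl | rfl, e⟩ := h1 _ (.inr rfl)
    · exact (proj_tag_ne_ord e).elim
    · exact tag_inj hb e

/-! #### Elements and levels of the tree -/

/-- Pairs are matched by replacing the coordinate `k` by `l` in one direction and cutting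
coordinates off at `k` in the other, as stage `k` identifies all ordinals `≥ k`. -/
theorem proj_elem_eq {k l : Ordinal.{u}} (h : k ≤ l) {S S' : Set (Ordinal.{u} × Ordinal.{u})}
    (hS : S' ∩ box k = S) : π (succ k) (elem k S) = π (succ k) (elem l S') := by
  subst hS
  refine Raw.proj_succ_eq_iff.2 ⟨fun x hx => ?_, fun x hx => ?_⟩
  · obtain ⟨a, ha, b, hb, hab, rfl⟩ := rel_elem.1 hx
    have aux : ∀ a ≤ k, ∃ a' ≤ l, (a = a' ∨ k ≤ a ∧ k ≤ a') ∧ (a' < l → a' = a ∧ a < k) := by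
      intro a ha
      rcases ha.lt_or_eq with h1 | rfl
      · exact ⟨a, ha.trans h, .inl rfl, fun _ => ⟨rfl, h1⟩⟩
      · exact ⟨l, le_rfl, .inr ⟨le_rfl, h⟩, fun h => (h.false).elim⟩
    obtain ⟨a', ha', h1, h2⟩ := aux a ha
    obtain ⟨b', hb', h3, h4⟩ := aux b hb
    refine ⟨_, rel_elem.2 ⟨a', ha', b', hb', fun h5 h6 => ?_, rfl⟩, proj_pair_eq h1 h3⟩
    obtain ⟨rfl, h7⟩ := h2 h5
    obtain ⟨rfl, h8⟩ := h4 h6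
    exact (hab h7 h8).1
  · obtain ⟨a, ha, b, hb, hab, rfl⟩ := rel_elem.1 hx
    have aux : ∀ a : Ordinal.{u}, min a k = a ∨ k ≤ min a k ∧ k ≤ a := by
      intro a
      rcases le_total a k with h1 | h1
      · exact .inl (min_eq_left h1)
      · exact .inr ⟨le_min h1 le_rfl, h1⟩
    refine ⟨_, rel_elem.2 ⟨min a k, min_le_right _ _, min b k, min_le_right _ _, fun h1 h2 => ?_,
      rfl⟩, proj_pair_eq (aux a) (aux b)⟩
    have h3 : a < k := by simpa using h1
    have h4 : b < k := by simpa using h2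
    rw [min_eq_left h3.le, min_eq_left h4.le]
    exact ⟨hab (h3.trans_le h) (h4.trans_le h), h3, h4⟩

/-- The offset `4` pays for the layers of the coding: one stage each for the element, the pair and
the tag, and one for the `succ` in the tag. -/
theorem mem_of_proj_elem_eq {k l l' a b : Ordinal.{u}} {S S' : Set (Ordinal.{u} × Ordinal.{u})}
    (hl : k ≤ l) (hl' : k ≤ l') (h : π (k + 4) (elem l S) = π (k + 4) (elem l' S')) (ha : a < k)
    (hb : b < k) (hab : (a, b) ∈ S) : (a, b) ∈ S' := by
  have e : k + 4 = succ (succ (succ (succ k))) := by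
    simp only [succ_eq_add_one, add_assoc]
    norm_num
  rw [e] at h
  obtain ⟨y, hy, h1⟩ := (Raw.proj_succ_eq_iff.1 h).1 _
    (rel_elem.2 ⟨a, (ha.trans_le hl).le, b, (hb.trans_le hl).le, fun _ _ => hab, rfl⟩)
  obtain ⟨a', -, b', -, h2, rfl⟩ := rel_elem.1 hy
  obtain ⟨rfl, rfl⟩ := pair_inj ha hb h1
  exact h2 (ha.trans_le hl') (hb.trans_le hl')

end TreeState

namespace BranchlessTree

variable {κ : WithTop Cardinal.{u}} {i : Ordinal.{u}} (T : BranchlessTree κ i)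

/-- The transition system coding the tree. -/
abbrev Rel : TreeState.{u} → TreeState.{u} → Prop := TreeState.Rel T.level i

theorem proj_family_eq {k l : Ordinal.{u}} (h : k ≤ l) (hl : l < i) :
    Raw.proj T.Rel k (.family k) = Raw.proj T.Rel k (.family l) := by
  refine Raw.proj_eq_of_le (le_succ k) (Raw.proj_succ_eq_iff.2 ⟨?_, ?_⟩)
  · rintro _ ⟨S, hS, rfl⟩
    obtain ⟨S', hS', e⟩ := (T.restrict k l h hl S).1 hS
    exact ⟨_, ⟨S', hS', rfl⟩, Raw.proj_eq_of_le (le_succ k) (TreeState.proj_elem_eq h e)⟩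
  · rintro _ ⟨S', hS', rfl⟩
    exact ⟨_, ⟨_, (T.restrict k l h hl _).2 ⟨S', hS', rfl⟩, rfl⟩,
      Raw.proj_eq_of_le (le_succ k) (TreeState.proj_elem_eq h rfl)⟩

/-- The hypotheses under which the transition system of a tree is used. -/
structure Admissible (κ : WithTop Cardinal.{u}) (i : Ordinal.{u}) : Prop where
  regular : BoundRegular κ
  limit : IsSuccPrelimit i
  bound : ∀ l < i, ¬ BoundLE κ l

/-- The states that are reachable, except for the root if `κ ≤ i`. -/
def Reachable (κ : WithTop Cardinal.{u}) (i : Ordinal.{u}) : TreeState.{u} → Prop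
  | .ord a => a < i
  | .tag a => a < i
  | .pair a b => a < i ∧ b < i
  | .elem l _ => l < i
  | .family l => l < i
  | .root => ¬ BoundLE κ i

theorem reachable_spec (h : Admissible κ i) (x : TreeState.{u}) (hx : Reachable κ i x) :
    SizeLT κ {y // T.Rel x y} ∧ ∀ y, T.Rel x y → Reachable κ i y := by
  cases x with
  | ord a =>
    refine ⟨(sizeLT_Iio (h.bound a hx)).of_surjective (fun b => ⟨.ord b.1, b.1, b.2, rfl⟩) ?_, ?_⟩
    · rintro ⟨_, b, hb, rfl⟩
      exact ⟨⟨b, hb⟩, rfl⟩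
    · rintro _ ⟨b, hb, rfl⟩
      exact hb.trans hx
  | tag a =>
    refine ⟨@BoundRegular.sizeLT_of_finite _ h.regular _ (Set.finite_singleton _), ?_⟩
    rintro _ rfl
    exact h.limit.succ_lt hx
  | pair a b =>
    refine ⟨@BoundRegular.sizeLT_of_finite _ h.regular _
      ((Set.finite_singleton _).insert _), ?_⟩
    rintro _ (rfl | rfl)
    · exact hx.1
    · exact hx.2
  | elem l S =>
    have hl := sizeLT_Iio (h.bound _ (h.limit.succ_lt hx))
    refine ⟨((hl.prod h.regular hl).of_injective (α := Set.Iio (succ l) × Set.Iio (succ l))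
      (β := {p : Set.Iio (succ l) × Set.Iio (succ l) //
        p.1.1 < l → p.2.1 < l → (p.1.1, p.2.1) ∈ S}) _
      Subtype.val_injective).of_surjective (fun p => ⟨.pair p.1.1.1 p.1.2.1, p.1.1.1,
        lt_succ_iff.1 p.1.1.2, p.1.2.1, lt_succ_iff.1 p.1.2.2, p.2, rfl⟩) ?_, ?_⟩
    · rintro ⟨_, a, ha, b, hb, hab, rfl⟩
      exact ⟨⟨⟨⟨a, lt_succ_iff.2 ha⟩, ⟨b, lt_succ_iff.2 hb⟩⟩, hab⟩, rfl⟩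
    · rintro _ ⟨a, ha, b, hb, hab, rfl⟩
      exact ⟨lt_of_le_of_lt ha hx, lt_of_le_of_lt hb hx⟩
  | family l =>
    refine ⟨(T.size l hx).of_surjective (fun S => ⟨.elem l S.1, S.1, S.2, rfl⟩) ?_, ?_⟩
    · rintro ⟨_, S, hS, rfl⟩
      exact ⟨⟨S, hS⟩, rfl⟩
    · rintro _ ⟨S, hS, rfl⟩
      exact hx
  | root =>
    refine ⟨(sizeLT_Iio hx).of_surjective (fun b => ⟨.family b.1, b.1, b.2, rfl⟩) ?_, ?_⟩
    · rintro ⟨_, b, hb, rfl⟩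
      exact ⟨⟨b, hb⟩, rfl⟩
    · rintro _ ⟨b, hb, rfl⟩
      exact hb

theorem isBranching (h : Admissible κ i) {x : TreeState.{u}} (hx : Reachable κ i x) :
    IsBranching κ T.Rel x :=
  isBranching_of_invariant (Reachable κ i) (T.reachable_spec h) hx

/-! ### The element at level `i` defined by the levels of the tree -/

/-- The element of level `i` whose `k`th component describes the `k`th level of the tree. -/
noncomputable def ghost (h : Admissible κ i) : Raw i :=
  (Raw.limitEquiv h.limit).symm fun k => Raw.proj T.Rel k.1 (.family k.1)

theorem conn_ghost (h : Admissible κ i) {k l : Ordinal.{u}} (hkl : k ≤ l) (hl : l < i) :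
    Raw.conn i k (hkl.trans hl.le) (T.ghost h) = Raw.proj T.Rel k (.family l) := by
  rw [Raw.conn_limit h.limit (hkl.trans_lt hl), ghost, Equiv.apply_symm_apply,
    ← T.proj_family_eq hkl hl]

theorem ghost_mem_level (h : Admissible κ i) : T.ghost h ∈ Raw.level κ i := by
  refine (Raw.mem_level_limit h.limit).2 ⟨fun k => ?_, fun k l hkl => ?_⟩
  · rw [ghost, Equiv.apply_symm_apply]
    exact Raw.proj_mem_level _ _ _ (T.isBranching h k.2)
  · rw [ghost, Equiv.apply_symm_apply, Raw.conn_proj]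
    exact (T.proj_family_eq hkl l.2).symm

/-- The coordinates of a successor are images of sets `S l` in level `l + 1` of the tree. Since
stage `k + 4` determines a set on `box k`, these sets agree on small boxes and glue to a full
branch. -/
theorem not_limitStep_ghost (h : Admissible κ i) (b' : Raw i) (hb' : b' ∈ Raw.level ⊤ i) :
    ¬ LimitStep (T.ghost h) b' := by
  intro hs
  have h4 : ∀ {l}, l < i → l + 4 < i := by
    intro l hl
    have e : l + 4 = succ (succ (succ (succ l))) := by
      simp only [succ_eq_add_one, add_assoc]
      norm_num
    rw [e]
    exact h.limit.succ_lt (h.limit.succ_lt (h.limit.succ_lt (h.limit.succ_lt hl)))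
  have h1 : ∀ (l : Ordinal.{u}) (hl : l < i), ∃ S ∈ T.level (succ l),
      Raw.proj T.Rel l (.elem (succ l) S) = Raw.conn i l hl.le b' := by
    intro l hl
    have h2 := hs l hl
    rw [T.conn_ghost h le_rfl (h.limit.succ_lt hl), Raw.mem_proj_succ] at h2
    obtain ⟨_, ⟨S, hS, rfl⟩, e⟩ := h2
    exact ⟨S, hS, e⟩
  choose S hS hSb using h1
  have key : ∀ {k l m a b : Ordinal.{u}} (hl : l < i) (hm : m < i), k + 4 ≤ l → k + 4 ≤ m →
      a < k → b < k → (a, b) ∈ S l hl → (a, b) ∈ S m hm := by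
    intro k l m a b hl hm hkl hkm ha hb hab
    have hk : k ≤ k + 4 := le_self_add
    have e : ∀ (l : Ordinal.{u}) (hl : l < i) (h : k + 4 ≤ l),
        Raw.proj T.Rel (k + 4) (.elem (succ l) (S l hl)) = Raw.conn i (k + 4) (h.trans hl.le) b' :=
      fun l hl h => by rw [← Raw.conn_proj _ l _ _ h, hSb, Raw.conn_conn hb']
    exact TreeState.mem_of_proj_elem_eq (hk.trans (hkl.trans (le_succ l)))
      (hk.trans (hkm.trans (le_succ m))) ((e l hl hkl).trans (e m hm hkm).symm) ha hb hab
  -- The shift by `4` ensures that `S (m + 4)` is already final on `box m`.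
  refine T.no_branch {p | ∃ (m : Ordinal.{u}) (hm : m < i), p ∈ box m ∧ p ∈ S (m + 4) (h4 hm)}
    fun l hl => ?_
  refine (T.restrict l (succ (l + 4)) (le_self_add.trans (le_succ (l + 4)))
    (h.limit.succ_lt (h4 hl)) _).2 ⟨S (l + 4) (h4 hl), hS _ _, ?_⟩
  ext ⟨a, b⟩
  constructor
  · rintro ⟨h1, h2⟩
    exact ⟨⟨l, hl, h2, h1⟩, h2⟩
  · rintro ⟨⟨m, hm, ⟨h1, h2⟩, h3⟩, h4, h5⟩
    refine ⟨key (k := min l m) _ _ ?_ ?_ (lt_min h4 h1) (lt_min h5 h2) h3, h4, h5⟩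
    · exact add_le_add_left (min_le_right _ _) _
    · exact add_le_add_left (min_le_left _ _) _

theorem exists_rel_family {l : Ordinal.{u}} (hl : l < i) : ∃ y, T.Rel (.family l) y := by
  obtain ⟨S, hS⟩ := T.nonempty l hl
  exact ⟨_, S, hS, rfl⟩

end BranchlessTree

end GhostChain

/-! ### Construction of trees without full branches -/

namespace GhostChain

/-! ### Trees of finite sequences -/

/-- The last element of the sequence `a :: t`. -/
def lastOf : Ordinal.{u} → List Ordinal.{u} → Ordinal.{u}
  | a, [] => a
  | _, b :: t => lastOf b t

/-- The sequence `a :: t` is strictly increasing, and all elements of `t` are in `A`. -/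
def IncreasingIn (A : Set Ordinal.{u}) : Ordinal.{u} → List Ordinal.{u} → Prop
  | _, [] => True
  | a, b :: t => a < b ∧ b ∈ A ∧ IncreasingIn A b t

/-- The set of pairs coding the sequence `a :: t`: at each element, the value of `f` at the next
element is stored. -/
def seqCode (f : Ordinal.{u} → Set Ordinal.{u}) :
    Ordinal.{u} → List Ordinal.{u} → Set (Ordinal.{u} × Ordinal.{u})
  | _, [] => ∅
  | a, b :: t => {p | p.1 = a ∧ p.2 ∈ f b} ∪ seqCode f b t

section Sequences

variable {A : Set Ordinal.{u}} {f : Ordinal.{u} → Set Ordinal.{u}}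

theorem lastOf_append (a b : Ordinal.{u}) (t : List Ordinal.{u}) : lastOf a (t ++ [b]) = b := by
  induction t generalizing a with
  | nil => rfl
  | cons c t ih => exact ih c

theorem IncreasingIn.append {a b : Ordinal.{u}} {t : List Ordinal.{u}} (h : IncreasingIn A a t)
    (hb : b ∈ A) (hlt : lastOf a t < b) : IncreasingIn A a (t ++ [b]) := by
  induction t generalizing a with
  | nil => exact ⟨hlt, hb, trivial⟩
  | cons c t ih => exact ⟨h.1, h.2.1, ih h.2.2 hlt⟩

theorem IncreasingIn.subset {a : Ordinal.{u}} {t : List Ordinal.{u}} (h : IncreasingIn A a t) :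
    ∀ b ∈ t, b ∈ A := by
  induction t generalizing a with
  | nil => simp
  | cons c t ih =>
    intro b hb
    rcases List.mem_cons.1 hb with rfl | hb
    · exact h.2.1
    · exact ih h.2.2 b hb

theorem seqCode_append (a b : Ordinal.{u}) (t : List Ordinal.{u}) :
    seqCode f a (t ++ [b]) = seqCode f a t ∪ {p | p.1 = lastOf a t ∧ p.2 ∈ f b} := by
  induction t generalizing a with
  | nil => simp [seqCode, lastOf]
  | cons c t ih =>
    change _ ∪ seqCode f c (t ++ [b]) = (_ ∪ _) ∪ _
    rw [ih, Set.union_assoc]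
    rfl

theorem IncreasingIn.le_of_mem_seqCode {a : Ordinal.{u}} {t : List Ordinal.{u}}
    (h : IncreasingIn A a t) {p : Ordinal.{u} × Ordinal.{u}} (hp : p ∈ seqCode f a t) :
    a ≤ p.1 := by
  induction t generalizing a with
  | nil => exact hp.elim
  | cons c t ih =>
    rcases hp with hp | hp
    · exact hp.1.ge
    · exact h.1.le.trans (ih h.2.2 hp)

theorem IncreasingIn.mem_seqCode_cons_self {a b : Ordinal.{u}} {t : List Ordinal.{u}}
    (h : IncreasingIn A a (b :: t)) {x : Ordinal.{u}} :
    (a, x) ∈ seqCode f a (b :: t) ↔ x ∈ f b := by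
  constructor
  · rintro (hp | hp)
    · exact hp.2
    · exact absurd h.1 (not_lt.2 (h.2.2.le_of_mem_seqCode hp))
  · exact fun hx => .inl ⟨rfl, hx⟩

theorem mem_seqCode_cons_of_lt {a b x y : Ordinal.{u}} {t : List Ordinal.{u}} (h : a < x) :
    (x, y) ∈ seqCode f a (b :: t) ↔ (x, y) ∈ seqCode f b t := by
  constructor
  · rintro (hp | hp)
    · exact absurd hp.1 h.ne'
    · exact hp
  · exact .inr

theorem exists_bound_of_not_isOmegaCofinal {i : Ordinal.{u}} (hi : ¬ IsOmegaCofinal i)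
    (g : ℕ → Ordinal.{u}) (hg : StrictMono g) (hgi : ∀ n, g n < i) : ∃ l < i, ∀ n, g n ≤ l := by
  by_contra! h
  refine hi ⟨g, hg, ?_, fun l hl => ?_⟩
  · rintro _ ⟨n, rfl⟩
    exact (hgi n).le
  · by_contra hli
    obtain ⟨n, hn⟩ := h l (not_le.1 hli)
    exact (hl ⟨n, rfl⟩).not_gt hn

/-- No set of pairs codes an infinite sequence that is cofinal in `i`. -/
theorem not_forall_agree {i m : Ordinal.{u}} (hl : IsSuccPrelimit i) (hi : ¬ IsOmegaCofinal i)
    (hA : A ⊆ Set.Iio i) (hm : m < i) (hfm : ∀ a, f a ⊆ Set.Iio m) (hf : Set.InjOn f A)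
    (S : Set (Ordinal.{u} × Ordinal.{u}))
    (hS : ∀ l < i, ∃ t, IncreasingIn A 0 t ∧ l ≤ lastOf 0 t ∧
      seqCode f 0 t ∩ box l = S ∩ box l) (h0 : 0 < i) : False := by
  let Agree (a l : Ordinal.{u}) (t : List Ordinal.{u}) : Prop := IncreasingIn A a t ∧
    l ≤ lastOf a t ∧ ∀ x y, a ≤ x → x < l → y < l → ((x, y) ∈ seqCode f a t ↔ (x, y) ∈ S)
  let Next (a b : Ordinal.{u}) : Prop := a < b ∧ b ∈ A ∧ ∀ x < m, x ∈ f b ↔ (a, x) ∈ S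
  -- Row `a` of `S` reveals `f b` completely, as `f b ⊆ m`, and `f` is injective on `A`.
  have next_unique : ∀ {a b b'}, Next a b → Next a b' → b = b' := by
    intro a b b' h h'
    refine hf h.2.1 h'.2.1 (Set.ext fun x => ⟨fun hx => ?_, fun hx => ?_⟩)
    · exact (h'.2.2 x (hfm _ hx)).2 ((h.2.2 x (hfm _ hx)).1 hx)
    · exact (h.2.2 x (hfm _ hx)).2 ((h'.2.2 x (hfm _ hx)).1 hx)
  have agree_cons : ∀ {a b l t}, a < l → m ≤ l → Agree a l (b :: t) →
      Next a b ∧ Agree b l t := by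
    rintro a b l t hal hml ⟨h1, h2, h3⟩
    refine ⟨⟨h1.1, h1.2.1, fun x hx => ?_⟩, h1.2.2, h2, fun x y hbx hx hy => ?_⟩
    · rw [← h3 a x le_rfl hal (hx.trans_le hml), h1.mem_seqCode_cons_self]
    · rw [← h3 x y (h1.1.le.trans hbx) hx hy, mem_seqCode_cons_of_lt (h1.1.trans_le hbx)]
  have agree_mono : ∀ {a l l' t}, l ≤ l' → Agree a l' t → Agree a l t :=
    fun h ⟨h1, h2, h3⟩ => ⟨h1, h.trans h2, fun x y hx hxl hyl =>
      h3 x y hx (hxl.trans_le h) (hyl.trans_le h)⟩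
  -- At a good element, finite sequences approximate `S` up to every bound. Uniqueness of the next
  -- element makes that element good again, which yields an infinite sequence.
  let Good (a : Ordinal.{u}) : Prop := a < i ∧ ∀ l < i, ∃ t, Agree a l t
  have agree_next : ∀ {a l}, Good a → l < i → a < l → m ≤ l →
      ∃ b t, Next a b ∧ Agree b l t := by
    rintro a l ⟨-, ha⟩ hl hal hml
    obtain ⟨_ | ⟨b, t⟩, ht⟩ := ha l hl
    · exact absurd hal (not_lt.2 ht.2.1)
    · exact ⟨b, t, agree_cons hal hml ht⟩
  have good_next : ∀ a, Good a → ∃ b, Next a b ∧ Good b := by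
    intro a ha
    have hb0 : max (succ a) m < i := max_lt (hl.succ_lt ha.1) hm
    obtain ⟨b, -, hab, -⟩ := agree_next ha hb0
      ((lt_succ a).trans_le (le_max_left _ _)) (le_max_right _ _)
    refine ⟨b, hab, hA hab.2.1, fun l hl => ?_⟩
    obtain ⟨b', t, hab', ht⟩ := agree_next ha (max_lt hl hb0)
      (((lt_succ a).trans_le (le_max_left _ _)).trans_le (le_max_right _ _))
      ((le_max_right _ _).trans (le_max_right _ _))
    obtain rfl := next_unique hab hab'
    exact ⟨t, agree_mono (le_max_left _ _) ht⟩
  have good0 : Good 0 := by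
    refine ⟨h0, fun l hl => ?_⟩
    obtain ⟨t, h1, h2, h3⟩ := hS l hl
    refine ⟨t, h1, h2, fun x y _ hx hy => ?_⟩
    have := Set.ext_iff.1 h3 (x, y)
    constructor
    · exact fun h => (this.1 ⟨h, hx, hy⟩).1
    · exact fun h => (this.2 ⟨h, hx, hy⟩).1
  choose F hF using fun a : {a // Good a} => good_next a.1 a.2
  let s : ℕ → {a // Good a} := fun n => Nat.rec ⟨0, good0⟩ (fun _ a => ⟨F a, (hF a).2⟩) n
  have hs : ∀ n, Next (s n).1 (s (n + 1)).1 := fun n => (hF (s n)).1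
  obtain ⟨l, hli, hl'⟩ := exists_bound_of_not_isOmegaCofinal hi (fun n => (s n).1)
    (strictMono_nat_of_lt_succ fun n => (hs n).1) fun n => (s n).2.1
  -- The infinite sequence is bounded by `l`. A finite sequence agreeing with `S` beyond `l` must
  -- follow it term by term, yet has to end above `l`.
  have hlast : ∀ t n, ¬ Agree (s n).1 (max (succ l) m) t := by
    intro t
    induction t with
    | nil =>
      intro n h
      exact (((lt_succ l).trans_le (le_max_left _ _)).trans_le h.2.1).not_ge (hl' n)
    | cons b t ih =>
      intro n h
      obtain ⟨h1, h2⟩ := agree_cons (((hl' n).trans_lt (lt_succ l)).trans_le (le_max_left _ _))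
        (le_max_right _ _) h
      obtain rfl := next_unique h1 (hs n)
      exact ih (n + 1) h2
  obtain ⟨t, ht⟩ := (s 0).2.2 _ (max_lt (hl.succ_lt hli) hm)
  exact hlast t 0 ht

theorem sizeLT_list_Iio {κ : WithTop Cardinal.{u}} {i : Ordinal.{u}} (hl : IsSuccPrelimit i)
    (h0 : 0 < i) (hi : ¬ BoundLE κ i) : SizeLT κ (List (Set.Iio i)) := by
  have : Nonempty (Set.Iio i) := ⟨⟨0, h0⟩⟩
  have : NoMaxOrder (Set.Iio i) := ⟨fun a => ⟨⟨succ a.1, hl.succ_lt a.2⟩, lt_succ a.1⟩⟩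
  have : Infinite (Set.Iio i) := NoMaxOrder.infinite
  intro c hc
  rw [Cardinal.mk_list_eq_mk]
  exact sizeLT_Iio hi c hc

/-- A cofinal subset of `i` whose elements can be coded by subsets of some `m < i` gives rise to a
branchless tree. -/
def BranchlessTree.ofCode {κ : WithTop Cardinal.{u}} {i m : Ordinal.{u}} (hl : IsSuccPrelimit i)
    (h0 : 0 < i) (hκ : ¬ BoundLE κ i) (hi : ¬ IsOmegaCofinal i)
    (hA : A ⊆ Set.Iio i) (hcof : ∀ l < i, ∃ a ∈ A, l < a) (hm : m < i)
    (hfm : ∀ a, f a ⊆ Set.Iio m) (hf : Set.InjOn f A) : BranchlessTree κ i where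
  level l := {S | ∃ t, IncreasingIn A 0 t ∧ l ≤ lastOf 0 t ∧ seqCode f 0 t ∩ box l = S}
  nonempty l hl := by
    obtain ⟨a, ha, hla⟩ := hcof l hl
    exact ⟨_, [a], ⟨zero_le.trans_lt hla, ha, trivial⟩, hla.le, rfl⟩
  size l hl' := by
    have h1 : SizeLT κ {t : List Ordinal.{u} // IncreasingIn A 0 t ∧ l ≤ lastOf 0 t} := by
      refine (sizeLT_list_Iio hl h0 hκ).of_injective
        (fun t => t.1.pmap Subtype.mk fun b hb => hA (t.2.1.subset b hb)) fun s t h => ?_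
      have := congrArg (List.map Subtype.val) h
      rw [List.map_pmap, List.map_pmap] at this
      exact Subtype.ext (by simpa using this)
    refine h1.of_surjective (fun t => ⟨_, t.1, t.2.1, t.2.2, rfl⟩) ?_
    rintro ⟨_, t, h1, h2, rfl⟩
    exact ⟨⟨t, h1, h2⟩, rfl⟩
  restrict k l hkl hli S := by
    have hbox : box k ⊆ box l := fun p hp => ⟨hp.1.trans_le hkl, hp.2.trans_le hkl⟩
    constructor
    · rintro ⟨t, h1, h2, rfl⟩
      have hlast : lastOf 0 t < i := by
        rcases t.eq_nil_or_concat' with rfl | ⟨t, b, rfl⟩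
        · exact h0
        · rw [lastOf_append]
          exact hA (h1.subset b (by simp))
      -- Appending one large element extends `t` to level `l`. The new pairs have the old last
      -- element, which is `≥ k`, as first coordinate, so `box k` does not see them.
      obtain ⟨a, ha, hla⟩ := hcof _ (max_lt hli hlast)
      refine ⟨_, ⟨t ++ [a], h1.append ha ((le_max_right _ _).trans_lt hla), ?_, rfl⟩, ?_⟩
      · rw [lastOf_append]
        exact (le_max_left _ _).trans hla.le
      · rw [Set.inter_assoc, Set.inter_eq_right.2 hbox, seqCode_append, Set.union_inter_distrib_right,
          Set.union_eq_left]
        rintro p ⟨hp, hp'⟩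
        exact absurd hp'.1 (not_lt.2 (h2.trans hp.1.ge))
    · rintro ⟨_, ⟨t, h1, h2, rfl⟩, rfl⟩
      refine ⟨t, h1, hkl.trans h2, ?_⟩
      rw [Set.inter_assoc, Set.inter_eq_right.2 hbox]
  no_branch S hS := not_forall_agree hl hi hA hm hfm hf S hS h0

end Sequences

/-! ### Trees without full branches -/

section Tree

theorem exists_injective_lt_ord (A : Type u) :
    ∃ f : A → Ordinal.{u}, Function.Injective f ∧ ∀ a, f a < (#A).ord := by
  obtain ⟨e⟩ := Cardinal.eq.1 (Cardinal.mk_ord_toType (#A))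
  exact ⟨fun a => (Ordinal.ToType.mk.symm (e.symm a)).1, Subtype.val_injective.comp
    (Ordinal.ToType.mk.symm.injective.comp e.symm.injective), fun a =>
      (Ordinal.ToType.mk.symm (e.symm a)).2⟩

variable {c : Cardinal.{u}} (D : InverseChain.{u + 1, u} (Set.Iio c.ord))
  (f : ∀ k, D.level k → Ordinal.{u})

/-- The set of pairs coding the elements below `d`. -/
def treeSet {l : Set.Iio c.ord} (d : D.level l) : Set (Ordinal.{u} × Ordinal.{u}) :=
  {p | ∃ (k : Set.Iio c.ord) (hk : k ≤ l), p = (k.1, f k (D.conn hk d))}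

theorem mem_treeSet {f : ∀ k, D.level k → Ordinal.{u}} (hf : ∀ k, Function.Injective (f k))
    {k l : Set.Iio c.ord} (hk : k ≤ l) {d : D.level l} {e : D.level k} :
    (k.1, f k e) ∈ treeSet D f d ↔ D.conn hk d = e := by
  constructor
  · rintro ⟨k', hk', h⟩
    obtain rfl : k = k' := Subtype.ext (congrArg Prod.fst h)
    exact (hf k (congrArg Prod.snd h)).symm
  · rintro rfl
    exact ⟨k, hk, rfl⟩

theorem treeSet_conn_inter_box {k l : Set.Iio c.ord} (hkl : k ≤ l) (d : D.level l) :
    treeSet D f (D.conn hkl d) ∩ box k.1 = treeSet D f d ∩ box k.1 := by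
  ext p
  constructor
  · rintro ⟨⟨m, hm, rfl⟩, hp⟩
    rw [D.conn_conn] at hp ⊢
    exact ⟨⟨m, _, rfl⟩, hp⟩
  · rintro ⟨⟨m, hm, rfl⟩, hp⟩
    have hmk : m ≤ k := hp.1.le
    exact ⟨⟨m, hmk, by rw [D.conn_conn]⟩, hp⟩

/-- A tidy tree without full branches gives rise to a branchless tree of sets of pairs. -/
theorem InverseChain.IsTidy.nonempty_branchlessTree {κ : WithTop Cardinal.{u}}
    {D : InverseChain.{u + 1, u} (Set.Iio c.ord)}
    (hc : IsSuccPrelimit c.ord) (hD : D.IsTidy) (hs : ∀ k, #(D.level k) < c)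
    (hκ : ∀ A : Type u, #A < c → SizeLT κ A) (hb : ¬ ∃ x, D.IsFullBranch x) :
    Nonempty (BranchlessTree κ c.ord) := by
  choose f hf hfc using fun k => exists_injective_lt_ord (D.level k)
  have hne : ∀ l, Nonempty (D.level l) := fun l => by
    obtain ⟨k, hk, ⟨d⟩⟩ := hD.root
    exact (hD.surjective k l (hk l) d).nonempty
  refine ⟨⟨fun l => {S | ∃ (hl : l < c.ord) (d : D.level ⟨l, hl⟩), treeSet D f d ∩ box l = S},
    fun l hl => ?_, fun l hl => ?_, fun k l hkl hl S => ?_, fun S hS => ?_⟩⟩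
  · exact ⟨_, hl, Classical.choice (hne _), rfl⟩
  · refine (hκ _ (hs ⟨l, hl⟩)).of_surjective (fun d => ⟨_, hl, d, rfl⟩) ?_
    rintro ⟨_, _, d, rfl⟩
    exact ⟨d, rfl⟩
  · have hbox : box k ⊆ box l := fun p hp => ⟨hp.1.trans_le hkl, hp.2.trans_le hkl⟩
    have key : ∀ d : D.level ⟨l, hl⟩, treeSet D f (D.conn (j := ⟨k, hkl.trans_lt hl⟩) hkl d) ∩ box k
        = treeSet D f d ∩ box l ∩ box k := fun d => by
      rw [Set.inter_assoc, Set.inter_eq_right.2 hbox]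
      exact treeSet_conn_inter_box D f (k := ⟨k, hkl.trans_lt hl⟩) hkl d
    constructor
    · rintro ⟨hk, d, rfl⟩
      obtain ⟨e, rfl⟩ := hD.surjective ⟨k, hk⟩ ⟨l, hl⟩ hkl d
      exact ⟨_, ⟨hl, e, rfl⟩, (key e).symm⟩
    · rintro ⟨_, ⟨_, d, rfl⟩, rfl⟩
      exact ⟨hkl.trans_lt hl, _, key d⟩
  · choose hl d hd using hS
    -- Boxes show level `k` with a delay: all its codes lie in `box l` once `l` is at least this
    -- maximum. From then on `S` determines the restriction of `d l` to level `k`, so these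
    -- restrictions form a branch.
    have hbound : ∀ k : Set.Iio c.ord, max (succ k.1) (#(D.level k)).ord < c.ord := fun k =>
      max_lt (hc.succ_lt k.2) (ord_lt_ord.2 (hs k))
    have hmem : ∀ (k l : Set.Iio c.ord) (hkl : k ≤ l),
        max (succ k.1) (#(D.level k)).ord ≤ l.1 → ∀ e : D.level k,
        (k.1, f k e) ∈ S ↔ D.conn hkl (d l.1 l.2) = e := by
      intro k l hkl hl e
      have hbox : (k.1, f k e) ∈ box l.1 :=
        ⟨((lt_succ k.1).trans_le (le_max_left _ _)).trans_le hl,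
          ((hfc k e).trans_le (le_max_right _ _)).trans_le hl⟩
      rw [← mem_treeSet D hf hkl]
      have := Set.ext_iff.1 (hd l.1 l.2) (k.1, f k e)
      exact ⟨fun h => (this.2 ⟨h, hbox⟩).1, fun h => (this.1 ⟨h, hbox⟩).1⟩
    let g : Set.Iio c.ord → Set.Iio c.ord := fun k => ⟨_, hbound k⟩
    have hg : ∀ k, k ≤ g k := fun k => (le_succ k.1).trans (le_max_left _ _)
    let x : ∀ k, D.level k := fun k => D.conn (hg k) (d (g k).1 (g k).2)
    have hx : ∀ (k l : Set.Iio c.ord) (hkl : k ≤ l), g k ≤ l → D.conn hkl (d l.1 l.2) = x k :=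
      fun k l hkl h => (hmem k l hkl h _).1 ((hmem k (g k) (hg k) le_rfl _).2 rfl)
    refine hb ⟨x, fun j k hjk => ?_⟩
    have h1 := hx k (max (g j) (g k)) ((hg k).trans (le_max_right _ _)) (le_max_right _ _)
    have h2 := hx j (max (g j) (g k)) ((hg j).trans (le_max_left _ _)) (le_max_left _ _)
    rw [← h1, ← h2, D.conn_conn]

end Tree

/-! ### Limits that are not extensible -/

/-- The elements of a cofinal set of size `i.cof` are coded by singletons below `m = i.cof.ord`. -/
theorem BranchlessTree.nonempty_of_cof_lt {κ : WithTop Cardinal.{u}} {i : Ordinal.{u}}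
    (hl : IsSuccPrelimit i) (h0 : 0 < i) (hκ : ¬ BoundLE κ i) (hi : ¬ IsOmegaCofinal i)
    (hcof : i.cof.ord < i) : Nonempty (BranchlessTree κ i) := by
  obtain ⟨s, hs, hsc⟩ := Order.exists_cof_eq i.ToType
  rw [cof_toType] at hsc
  obtain ⟨h, hinj, hlt⟩ := exists_injective_lt_ord s
  rw [hsc] at hlt
  refine ⟨.ofCode (A := {b | ∃ a : s, (ToType.mk.symm a.1).1 = b})
    (f := fun b => {x | ∃ a : s, (ToType.mk.symm a.1).1 = b ∧ x = h a}) hl h0 hκ hi ?_ ?_ hcof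
    ?_ ?_⟩
  · rintro _ ⟨a, rfl⟩
    exact (ToType.mk.symm a.1).2
  · intro l hl'
    obtain ⟨a, ha, hla⟩ := hs (ToType.mk ⟨succ l, hl.succ_lt hl'⟩)
    refine ⟨_, ⟨⟨a, ha⟩, rfl⟩, succ_le_iff.1 ?_⟩
    exact ToType.mk.le_symm_apply.2 hla
  · rintro b _ ⟨a, -, rfl⟩
    exact hlt a
  · rintro _ ⟨a, rfl⟩ _ ⟨b, rfl⟩ e
    obtain ⟨b', h1, h2⟩ := (Set.ext_iff.1 e (h a)).1 ⟨a, rfl, rfl⟩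
    rw [hinj h2, h1]

/-- All ordinals below `c.ord` may occur in the sequences; an injection into the subsets of `A`
supplies codes inside `m = (#A).ord`. -/
theorem BranchlessTree.nonempty_of_le_mk_set {κ : WithTop Cardinal.{u}} {c : Cardinal.{u}}
    (hl : IsSuccPrelimit c.ord) (h0 : 0 < c.ord) (hκ : ¬ BoundLE κ c.ord)
    (hi : ¬ IsOmegaCofinal c.ord) {A : Type u} (hA : #A < c) (hcA : c ≤ #(Set A)) :
    Nonempty (BranchlessTree κ c.ord) := by
  obtain ⟨h, hinj, hlt⟩ := exists_injective_lt_ord A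
  rw [← Cardinal.mk_ord_toType c] at hcA
  obtain ⟨g⟩ := hcA
  refine ⟨.ofCode (A := Set.Iio c.ord)
    (f := fun b => {x | ∃ (hb : b < c.ord), ∃ a ∈ g (ToType.mk ⟨b, hb⟩), x = h a}) hl h0 hκ hi
    subset_rfl (fun l hl' => ⟨succ l, hl.succ_lt hl', lt_succ l⟩) (ord_lt_ord.2 hA) ?_ ?_⟩
  · rintro b _ ⟨_, a, -, rfl⟩
    exact hlt a
  · intro b hb b' hb' e
    have key : ∀ {b b' : Ordinal.{u}} (hb : b < c.ord) (hb' : b' < c.ord),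
        {x | ∃ (hb : b < c.ord), ∃ a ∈ g (ToType.mk ⟨b, hb⟩), x = h a} =
          {x | ∃ (hb : b' < c.ord), ∃ a ∈ g (ToType.mk ⟨b', hb⟩), x = h a} →
        g (ToType.mk ⟨b, hb⟩) ⊆ g (ToType.mk ⟨b', hb'⟩) := by
      intro b b' hb hb' e a ha
      obtain ⟨_, a', ha', e'⟩ := (Set.ext_iff.1 e (h a)).1 ⟨hb, a, ha, rfl⟩
      rwa [hinj e']
    have h1 := g.injective ((key hb hb' e).antisymm (key hb' hb e.symm))
    exact congrArg Subtype.val (ToType.mk.injective h1)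

/-- If `i` is a cardinal without the tree property, a witnessing tree is coded. Otherwise `κ ≤ i`
would make `i` extensible or contradict `hb`. Then either `i` exceeds its cofinality, or it is
regular with the tree property and, not being weakly compact, is below some power set of a smaller
set. -/
theorem BranchlessTree.nonempty_of_not_extensible {κ : WithTop Cardinal.{u}}
    {i : Ordinal.{u}} (hl : IsSuccPrelimit i)
    (hb : ∀ l < i, ¬ BoundLE κ l) (hi : ¬ Extensible κ i) : Nonempty (BranchlessTree κ i) := by
  have h0 : 0 < i := by
    rw [pos_iff_ne_zero]
    rintro rfl
    exact hi .zero
  have hω : ¬ IsOmegaCofinal i := fun h => hi (.omegaCofinal i h)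
  by_cases hT : ∃ c : Cardinal.{u}, i = c.ord ∧ ¬ TreeProperty c
  · obtain ⟨c, rfl, hT⟩ := hT
    obtain ⟨D, hD, hs, hx⟩ : ∃ D : InverseChain.{u + 1, u} (Set.Iio c.ord),
        D.IsTidy ∧ (∀ k, #(D.level k) < c) ∧ ¬ ∃ x, D.IsFullBranch x := by
      by_contra h
      exact hT fun D hD hs => by_contra fun hx => h ⟨D, hD, hs, hx⟩
    refine hD.nonempty_branchlessTree hl hs (fun A hA c' hc' => ?_) hx
    have hcc : c ≤ c' := by
      by_contra hcc
      exact hb c'.ord (ord_lt_ord.2 (not_le.1 hcc)) ⟨c', hc', le_rfl⟩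
    exact Cardinal.lift_lt.2 (hA.trans_le hcc)
  have hT' : ∀ c : Cardinal.{u}, i = c.ord → TreeProperty c := fun c hc => by
    by_contra h
    exact hT ⟨c, hc, h⟩
  have hbi : ¬ BoundLE κ i := by
    rintro ⟨c, hc, hci⟩
    rcases hci.eq_or_lt with h | h
    · exact hi (h ▸ .bound c hc (hT' c h.symm))
    · exact hb _ h ⟨c, hc, le_rfl⟩
  rcases (ord_cof_le i).lt_or_eq with h | h
  · exact nonempty_of_cof_lt hl h0 hbi hω h
  · have hreg : i.cof.IsRegular := isRegular_cof ⟨by simpa using h0.ne', hl⟩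
    have hnot : ¬ StronglyInaccessible i.cof := fun h' =>
      hi (h ▸ .weaklyCompact i.cof ⟨h', hT' _ h.symm⟩)
    obtain ⟨A, hA, hcA⟩ : ∃ A : Type u, #A < i.cof ∧ i.cof ≤ #(Set A) := by
      by_contra! h'
      exact hnot ⟨hreg, h'⟩
    generalize i.cof = c at h hA hcA
    subst h
    exact nonempty_of_le_mk_set hl h0 hbi hω hA hcA

end GhostChain

/-! ### Failures at non-extensible limits and the classification -/

namespace GhostChain

/-! ### Small systems -/

theorem proj_node_congr {i j : Ordinal.{u}} {a b : Raw i} (h : a = b) {ha : a ∈ Raw.level ⊤ i}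
    {hb : b ∈ Raw.level ⊤ i} : Raw.proj Step j (node a ha) = Raw.proj Step j (node b hb) := by
  subst h
  rfl

/-- The coding system lives in `Type (u + 1)`, but branching and projections depend only on the
reachable part, which is small. -/
theorem exists_small_system {X : Type v} (r : X → X → Prop) (x : X)
    [Small.{u} {y // Relation.ReflTransGen r x y}] :
    ∃ (X' : Type u) (r' : X' → X' → Prop) (x' : X'),
      (∀ κ : WithTop Cardinal.{u}, IsBranching κ r x → IsBranching κ r' x') ∧
        ∀ i : Ordinal.{u}, Raw.proj r' i x' = Raw.proj r i x := by
  let e := equivShrink.{u} {y // Relation.ReflTransGen r x y}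
  let f : Shrink.{u} {y // Relation.ReflTransGen r x y} → X := fun a => (e.symm a).1
  have hf : Function.Injective f := Subtype.val_injective.comp e.symm.injective
  have hfe : ∀ y, f (e y) = y.1 := fun y => congrArg Subtype.val (e.symm_apply_apply y)
  have hlift : ∀ a y, r (f a) y → ∃ b, r (f a) (f b) ∧ f b = y := fun a y h =>
    ⟨e ⟨y, (e.symm a).2.tail h⟩, by rwa [hfe], hfe _⟩
  have hproj : ∀ (i : Ordinal.{u}) (a), Raw.proj (fun a b => r (f a) (f b)) i a =
      Raw.proj r i (f a) := by
    intro i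
    induction i using SuccOrder.prelimitRecOn with
    | isSuccPrelimit i hi ih => exact fun a => (Raw.proj_limit_eq_iff hi).2 fun k hk => ih k hk a
    | succ i _ ih =>
      refine fun a => Raw.proj_succ_eq_iff.2 ⟨fun b hb => ⟨_, hb, ih b⟩, fun y hy => ?_⟩
      obtain ⟨b, hb, rfl⟩ := hlift a y hy
      exact ⟨b, hb, ih b⟩
  refine ⟨_, fun a b => r (f a) (f b), e ⟨x, .refl⟩, fun κ hx a ha => ?_, fun i => ?_⟩
  · refine (hx (f a) (e.symm a).2).of_injective (fun b => ⟨f b.1, b.2⟩) fun b c h => ?_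
    exact Subtype.ext (hf (Subtype.mk.inj h))
  · rw [hproj, hfe]

/-- The system `r` extended by a state whose only successor is `x`. -/
def OptionRel {X : Type v} (r : X → X → Prop) (x : X) : Option X → Option X → Prop
  | none, b => b = some x
  | some y, b => ∃ z, r y z ∧ b = some z

section OptionRel

variable {X : Type v} {r : X → X → Prop} {x : X}

theorem proj_optionRel_some (i : Ordinal.{u}) (y : X) :
    Raw.proj (OptionRel r x) i (some y) = Raw.proj r i y := by
  induction i using SuccOrder.prelimitRecOn generalizing y with
  | isSuccPrelimit i hi ih => exact (Raw.proj_limit_eq_iff hi).2 fun k hk => ih k hk y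
  | succ i _ ih =>
    refine Raw.proj_succ_eq_iff.2 ⟨?_, fun z hz => ⟨_, ⟨z, hz, rfl⟩, ih z⟩⟩
    rintro _ ⟨z, hz, rfl⟩
    exact ⟨z, hz, ih z⟩

theorem IsBranching.optionRel_none {κ : WithTop Cardinal.{u}} (hκ : BoundRegular κ)
    (hx : IsBranching κ r x) : IsBranching κ (OptionRel r x) none := by
  refine isBranching_of_invariant (fun a => ∀ y, a = some y → Relation.ReflTransGen r x y) ?_
    (fun y h => by cases h)
  rintro (_ | y) hy
  · refine ⟨@BoundRegular.sizeLT_of_finite _ hκ _ (Set.finite_singleton (some x)), ?_⟩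
    rintro _ rfl y h
    obtain rfl := Option.some_injective _ h
    exact .refl
  · refine ⟨(hx y (hy y rfl)).of_surjective (fun z => ⟨some z.1, z.1, z.2, rfl⟩) ?_, ?_⟩
    · rintro ⟨_, z, hz, rfl⟩
      exact ⟨⟨z, hz⟩, rfl⟩
    · rintro _ ⟨z, hz, rfl⟩ z' h
      obtain rfl := Option.some_injective _ h
      exact (hy y rfl).tail hz

end OptionRel

/-! ### Failure of faithfulness for systems -/

/-- Some `< κ`-branching system is not `∼ⱼ`-related to its image at level `j`. -/
def SystemFailure (κ : WithTop Cardinal.{u}) (j : Ordinal.{u}) : Prop :=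
  ∃ (X : Type u) (r : X → X → Prop) (x : X), IsBranching κ r x ∧
    Raw.proj Step j (node (Raw.proj r j x) (Raw.proj_mem_top r j x)) ≠ Raw.proj r j x

theorem SystemFailure.succ {κ : WithTop Cardinal.{u}} (hκ : BoundRegular κ) {j : Ordinal.{u}}
    (h : SystemFailure κ j) : SystemFailure κ (succ j) := by
  obtain ⟨X, r, x, hx, hne⟩ := h
  refine ⟨Option X, OptionRel r x, none, hx.optionRel_none hκ, fun e => hne ?_⟩
  obtain ⟨n, hn, e⟩ := (Raw.proj_succ_eq_iff.1 e).2 _ rfl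
  obtain ⟨b, hb, rfl⟩ := step_succ_iff.1 hn
  obtain ⟨_, rfl, hb⟩ := Raw.mem_proj_succ.1 hb
  rw [proj_optionRel_some] at hb e
  subst hb
  exact e

theorem SystemFailure.add_natCast {κ : WithTop Cardinal.{u}} (hκ : BoundRegular κ)
    {j : Ordinal.{u}} (h : SystemFailure κ j) (n : ℕ) : SystemFailure κ (j + n) := by
  induction n with
  | zero => simpa using h
  | succ n ih =>
    rw [Nat.cast_succ, ← add_assoc, ← succ_eq_add_one]
    exact ih.succ hκ

theorem exists_step_node_proj {X : Type v} {r : X → X → Prop} {x y : X} (h : r x y)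
    {j : Ordinal.{u}} (hj : 0 < j) :
    ∃ n, Step (node (Raw.proj r j x) (Raw.proj_mem_top r j x)) n := by
  induction j using SuccOrder.prelimitRecOn with
  | isSuccPrelimit j hl _ =>
    refine ⟨_, (step_limit_iff hl).2 ⟨_, Raw.proj_mem_top r j y, fun k hk => ?_, rfl⟩⟩
    rw [Raw.conn_proj, Raw.conn_proj, Raw.mem_proj_succ]
    exact ⟨y, h, rfl⟩
  | succ j _ _ => exact ⟨_, step_succ_iff.2 ⟨_, Raw.mem_proj_succ.2 ⟨y, h, rfl⟩, rfl⟩⟩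

namespace BranchlessTree

variable {κ : WithTop Cardinal.{u}} {i : Ordinal.{u}}

theorem ghost_mem_top (T : BranchlessTree κ i) (h : Admissible κ i) : T.ghost h ∈ Raw.level ⊤ i :=
  Raw.level_subset_top i (T.ghost_mem_level h)

theorem not_step_ghost (T : BranchlessTree κ i) (h : Admissible κ i) (n : Node.{u}) :
    ¬ Step (node (T.ghost h) (T.ghost_mem_top h)) n := by
  intro hn
  obtain ⟨b, hb, h', -⟩ := (step_limit_iff h.limit).1 hn
  exact T.not_limitStep_ghost h b hb h'

theorem step_root_ghost (T : BranchlessTree κ i) (h : Admissible κ i) :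
    Step (node (Raw.proj T.Rel i .root) (Raw.proj_mem_top _ i _))
      (node (T.ghost h) (T.ghost_mem_top h)) := by
  refine (step_limit_iff h.limit).2 ⟨_, _, fun k hk => ?_, rfl⟩
  rw [T.conn_ghost h le_rfl hk, Raw.conn_proj, Raw.mem_proj_succ]
  exact ⟨_, ⟨k, hk, rfl⟩, rfl⟩

theorem small_reachable (T : BranchlessTree κ i) (hi : IsSuccPrelimit i) :
    Small.{u} {y // Relation.ReflTransGen T.Rel .root y} := by
  have hbox : Small.{u} (box i) := inferInstanceAs (Small.{u} (Set.Iio i ×ˢ Set.Iio i :))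
  let V : Set TreeState.{u} := (.ord '' Set.Iio i) ∪ (.tag '' Set.Iio i) ∪
    ((fun p : _ × _ => .pair p.1 p.2) '' box i) ∪
    ((fun p : _ × _ => .elem p.1 p.2) '' (Set.Iio i ×ˢ 𝒫 (box i))) ∪
    (.family '' Set.Iio i) ∪ {.root}
  have hV : Small.{u} V := inferInstance
  have hsub : {y | Relation.ReflTransGen T.Rel .root y} ⊆ V := by
    intro y hy
    induction hy with
    | refl => exact .inr rfl
    | tail _ h ih =>
      rcases ih with ((((⟨a, ha, rfl⟩ | ⟨a, ha, rfl⟩) | ⟨p, hp, rfl⟩) | ⟨p, hp, rfl⟩) |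
        ⟨l, hl, rfl⟩) | rfl
      · obtain ⟨b, hb, rfl⟩ := h
        exact .inl (.inl (.inl (.inl (.inl ⟨b, hb.trans ha, rfl⟩))))
      · obtain rfl := h
        exact .inl (.inl (.inl (.inl (.inl ⟨_, hi.succ_lt ha, rfl⟩))))
      · rcases h with rfl | rfl
        · exact .inl (.inl (.inl (.inl (.inl ⟨_, hp.1, rfl⟩))))
        · exact .inl (.inl (.inl (.inl (.inr ⟨_, hp.2, rfl⟩))))
      · obtain ⟨a, ha, b, hb, -, rfl⟩ := h
        exact .inl (.inl (.inl (.inr ⟨(a, b), ⟨lt_of_le_of_lt ha hp.1, lt_of_le_of_lt hb hp.1⟩,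
          rfl⟩)))
      · obtain ⟨S, hS, rfl⟩ := h
        obtain ⟨S', -, rfl⟩ := (T.restrict l l le_rfl hl S).1 hS
        exact .inl (.inl (.inr ⟨(l, S' ∩ box l), ⟨hl, fun p hp =>
          ⟨hp.2.1.trans hl, hp.2.2.trans hl⟩⟩, rfl⟩))
      · obtain ⟨l, hl, rfl⟩ := h
        exact .inl (.inr ⟨l, hl, rfl⟩)
  exact small_subset hsub

theorem pos (T : BranchlessTree κ i) : 0 < i := by
  rw [pos_iff_ne_zero]
  rintro rfl
  exact T.no_branch ∅ fun l hl => (not_lt_bot hl).elim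

theorem succ_succ_zero_lt (T : BranchlessTree κ i) (h : Admissible κ i) : succ (succ 0) < i :=
  h.limit.succ_lt (h.limit.succ_lt T.pos)

/-- The image of the root at level `i` steps to the ghost, which has no transition, while every
successor of the root itself has one; two stages detect this. -/
theorem systemFailure (T : BranchlessTree κ i) (h : Admissible κ i) (hi : ¬ BoundLE κ i) : SystemFailure κ i := by
  have := T.small_reachable h.limit
  obtain ⟨X, r, x, h1, h2⟩ := exists_small_system.{u} T.Rel TreeState.root
  refine ⟨X, r, x, h1 κ (T.isBranching h hi), fun e => ?_⟩
  have e' := Raw.proj_eq_of_le (T.succ_succ_zero_lt h).le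
    ((proj_node_congr (ha := Raw.proj_mem_top _ _ _) (h2 i).symm).trans (e.trans (h2 i)))
  obtain ⟨y, hy, e2⟩ := (Raw.proj_succ_eq_iff.1 e').1 _ (T.step_root_ghost h)
  obtain ⟨l, hl, rfl⟩ := hy
  obtain ⟨z, hz⟩ := T.exists_rel_family hl
  obtain ⟨n, hn, -⟩ := (Raw.proj_succ_eq_iff.1 e2).2 _ hz
  exact T.not_step_ghost h n hn

end BranchlessTree

/-! ### Failure of faithfulness for elements of the final chain -/

/-- Some element of level `i` is not `∼ⱼ`-related to its restriction to level `j`. -/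
def LevelFailure (κ : WithTop Cardinal.{u}) (j i : Ordinal.{u}) : Prop :=
  ∃ (hji : j ≤ i) (a : Raw i) (ha : a ∈ Raw.level κ i),
    Raw.proj Step j (node (Raw.conn i j hji a)
      (Raw.level_subset_top j (Raw.conn_mem ha hji))) ≠
    Raw.proj Step j (node a (Raw.level_subset_top i ha))

/-- The singleton shape. -/
def Raw.singleton {i : Ordinal.{u}} (a : Raw i) : Raw (succ i) := (Raw.succEquiv i).symm {a}

theorem Raw.mem_singleton {i : Ordinal.{u}} {a b : Raw i} :
    b ∈ Raw.succEquiv i a.singleton ↔ b = a := by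
  rw [Raw.singleton, Equiv.apply_symm_apply]
  rfl

theorem Raw.singleton_mem_level {κ : WithTop Cardinal.{u}} (hκ : BoundRegular κ)
    {i : Ordinal.{u}} {a : Raw i} (ha : a ∈ Raw.level κ i) :
    a.singleton ∈ Raw.level κ (succ i) := by
  rw [Raw.mem_level_succ, Raw.singleton, Equiv.apply_symm_apply]
  exact ⟨@BoundRegular.sizeLT_of_finite _ hκ _ (Set.finite_singleton a),
    Set.singleton_subset_iff.2 ha⟩

theorem LevelFailure.succ_succ {κ : WithTop Cardinal.{u}} (hκ : BoundRegular κ)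
    {j i : Ordinal.{u}} (h : LevelFailure κ j i) : LevelFailure κ (succ j) (succ i) := by
  obtain ⟨hji, a, ha, hne⟩ := h
  refine ⟨succ_le_succ hji, a.singleton, Raw.singleton_mem_level hκ ha, fun e => hne ?_⟩
  obtain ⟨n, hn, e⟩ := (Raw.proj_succ_eq_iff.1 e).1 _ (step_succ_iff.2
    ⟨_, (Raw.mem_conn_succ hji _).2 ⟨a, Raw.mem_singleton.2 rfl, rfl⟩, rfl⟩)
  obtain ⟨b, hb, rfl⟩ := step_succ_iff.1 hn
  obtain rfl := Raw.mem_singleton.1 hb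
  exact e

/-- At a limit `j`, the restriction of the singleton of `a` steps to the restriction of `a`, and the
singleton steps to `a` only. Agreement for the singleton would thus give agreement for `a` at every
`k < j`, hence at `j`. -/
theorem LevelFailure.succ_right {κ : WithTop Cardinal.{u}} (hκ : BoundRegular κ)
    {j i : Ordinal.{u}} (hj : IsSuccPrelimit j) (h : LevelFailure κ j i) :
    LevelFailure κ j (succ i) := by
  obtain ⟨hji, a, ha, hne⟩ := h
  have ha' := Raw.singleton_mem_level hκ ha
  refine ⟨hji.trans (le_succ i), a.singleton, ha', fun e => hne ?_⟩
  refine (Raw.proj_limit_eq_iff hj).2 fun k hk => ?_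
  have hstep : Step (node (Raw.conn (succ i) j (hji.trans (le_succ i)) a.singleton)
      (Raw.level_subset_top j (Raw.conn_mem ha' _)))
      (node (Raw.conn i j hji a) (Raw.level_subset_top j (Raw.conn_mem ha hji))) := by
    refine (step_limit_iff hj).2 ⟨_, _, fun k hk => ?_, rfl⟩
    rw [Raw.conn_conn ha, Raw.conn_conn ha', Raw.mem_conn_succ (hk.le.trans hji)]
    exact ⟨a, Raw.mem_singleton.2 rfl, rfl⟩
  obtain ⟨n, hn, e⟩ := (Raw.proj_succ_eq_iff.1
    (Raw.proj_eq_of_le (succ_le_of_lt hk) e)).1 _ hstep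
  obtain ⟨b, hb, rfl⟩ := step_succ_iff.1 hn
  obtain rfl := Raw.mem_singleton.1 hb
  exact e

theorem LevelFailure.add_natCast {κ : WithTop Cardinal.{u}} (hκ : BoundRegular κ)
    {j i : Ordinal.{u}} (h : LevelFailure κ j i) (n : ℕ) : LevelFailure κ (j + n) (i + n) := by
  induction n with
  | zero => simpa using h
  | succ n ih =>
    rw [Nat.cast_succ, ← add_assoc, ← add_assoc, ← succ_eq_add_one, ← succ_eq_add_one]
    exact ih.succ_succ hκ

theorem LevelFailure.add_natCast_right {κ : WithTop Cardinal.{u}} (hκ : BoundRegular κ)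
    {j i : Ordinal.{u}} (hj : IsSuccPrelimit j) (h : LevelFailure κ j i) (n : ℕ) :
    LevelFailure κ j (i + n) := by
  induction n with
  | zero => simpa using h
  | succ n ih =>
    rw [Nat.cast_succ, ← add_assoc, ← succ_eq_add_one]
    exact ih.succ_right hκ hj

namespace BranchlessTree

variable {κ : WithTop Cardinal.{u}} {i : Ordinal.{u}}

/-- The restriction of the ghost to `j > 0` is the image of a nonempty tree level and has a
transition; the ghost has none, so stage `1` separates them. -/
theorem levelFailure_of_lt (T : BranchlessTree κ i) (h : Admissible κ i) {j : Ordinal.{u}} (h0 : 0 < j) (hj : j < i) :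
    LevelFailure κ j i := by
  refine ⟨hj.le, T.ghost h, T.ghost_mem_level h, fun e => ?_⟩
  have e' := Raw.proj_eq_of_le (succ_le_of_lt h0) e
  obtain ⟨y, hy⟩ := T.exists_rel_family hj
  obtain ⟨n, hn⟩ := exists_step_node_proj hy h0
  obtain ⟨m, hm, -⟩ := (Raw.proj_succ_eq_iff.1
    ((proj_node_congr (T.conn_ghost h le_rfl hj).symm).trans e')).1 n hn
  exact T.not_step_ghost h m hm

/-- At level `i + 1` the image of the root has only images of tree levels as members, and these have
transitions; restricting to level `i` adds the ghost. -/
theorem levelFailure_succ (T : BranchlessTree κ i) (h : Admissible κ i) (hi : ¬ BoundLE κ i) :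
    LevelFailure κ i (succ i) := by
  refine ⟨le_succ i, Raw.proj T.Rel (succ i) .root,
    Raw.proj_mem_level _ _ _ (T.isBranching h hi), fun e => ?_⟩
  have e' := Raw.proj_eq_of_le (T.succ_succ_zero_lt h).le
    ((proj_node_congr (ha := Raw.proj_mem_top _ _ _)
      (Raw.conn_proj T.Rel (succ i) .root i (le_succ i)).symm).trans e)
  obtain ⟨n, hn, e2⟩ := (Raw.proj_succ_eq_iff.1 e').1 _ (T.step_root_ghost h)
  obtain ⟨b, hb, rfl⟩ := step_succ_iff.1 hn
  obtain ⟨_, ⟨l, hl, rfl⟩, rfl⟩ := Raw.mem_proj_succ.1 hb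
  obtain ⟨y, hy⟩ := T.exists_rel_family hl
  obtain ⟨n, hn⟩ := exists_step_node_proj hy T.pos
  obtain ⟨m, hm, -⟩ := (Raw.proj_succ_eq_iff.1 e2).2 n hn
  exact T.not_step_ghost h m hm

end BranchlessTree

/-! ### The classification -/

theorem BoundLE.mono {κ : WithTop Cardinal.{u}} {j i : Ordinal.{u}} (h : BoundLE κ j)
    (hji : j ≤ i) : BoundLE κ i := by
  obtain ⟨c, hc, hcj⟩ := h
  exact ⟨c, hc, hcj.trans hji⟩

theorem add_omega0_le_of_lt {i j : Ordinal.{u}} (hi : IsSuccPrelimit i) (h : j < i) :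
    j + ω ≤ i := by
  by_contra hlt
  have h1 : i - j < ω := (Ordinal.sub_lt_of_le h.le).2 (not_le.1 hlt)
  obtain ⟨n, hn⟩ := lt_omega0.1 h1
  have h2 : i = j + n := by rw [← hn, Ordinal.add_sub_cancel_of_le h.le]
  cases n with
  | zero => simp [h2] at h
  | succ n =>
    rw [Nat.cast_succ, ← add_assoc, ← succ_eq_add_one] at h2
    exact hi.succ_ne _ h2.symm

theorem admissible_of_not_extensible {κ : WithTop Cardinal.{u}} (hκ : BoundRegular κ)
    {i : Ordinal.{u}} (hl : IsSuccPrelimit i) (hi : ¬ Extensible κ i) :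
    BranchlessTree.Admissible κ i where
  regular := hκ
  limit := hl
  bound l hli := by
    rintro ⟨c, hc, hcl⟩
    exact hi (.large c i hc hl (add_omega0_le_of_lt hl (hcl.trans_lt hli)))

theorem limitPart_le (i : Ordinal.{u}) : limitPart i ≤ i := by
  conv_rhs => rw [← (limitPart_finitePart i).2.2]
  exact le_self_add

theorem limitPart_mono {j i : Ordinal.{u}} (h : j ≤ i) : limitPart j ≤ limitPart i :=
  mul_le_mul_right (Ordinal.div_le_left h ω) ω

theorem systemFailure_of_not_extensible {κ : WithTop Cardinal.{u}} (hκ : BoundRegular κ)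
    {j : Ordinal.{u}} (hj : ¬ BoundLE κ j) (h : ¬ Extensible κ (limitPart j)) :
    SystemFailure κ j := by
  obtain ⟨h1, ⟨n, hn⟩, h3⟩ := limitPart_finitePart j
  have hadm := admissible_of_not_extensible hκ h1 h
  obtain ⟨T⟩ := BranchlessTree.nonempty_of_not_extensible h1 hadm.bound h
  have := (T.systemFailure hadm fun h => hj (h.mono (limitPart_le j))).add_natCast hκ n
  rwa [← hn, h3] at this

theorem levelFailure_of_not_extensible {κ : WithTop Cardinal.{u}} (hκ : BoundRegular κ)
    {j i : Ordinal.{u}} (hji : j < i) (hj : ¬ BoundLE κ j) (hfin : ¬ j ≤ finitePart i)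
    (h : ¬ Extensible κ (limitPart i)) : LevelFailure κ j i := by
  obtain ⟨h1, ⟨n, hn⟩, h3⟩ := limitPart_finitePart i
  obtain ⟨k1, ⟨m, hm⟩, k3⟩ := limitPart_finitePart j
  have hadm := admissible_of_not_extensible hκ h1 h
  obtain ⟨T⟩ := BranchlessTree.nonempty_of_not_extensible h1 hadm.bound h
  have hmono := limitPart_mono hji.le
  rw [hn] at hfin h3
  rw [hm] at k3
  generalize limitPart i = L at *
  generalize limitPart j = K at *
  subst h3 k3
  rcases hmono.eq_or_lt with rfl | hlt
  · have hmn : m < n := by simpa using hji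
    obtain ⟨p, rfl⟩ := Nat.exists_eq_add_of_lt hmn
    have h4 := ((T.levelFailure_succ hadm fun h => hj (h.mono le_self_add)).add_natCast_right
      hκ h1 p).add_natCast hκ m
    rwa [succ_eq_add_one, add_assoc, add_assoc, ← Nat.cast_one, ← Nat.cast_add, ← Nat.cast_add,
      show 1 + (p + m) = m + p + 1 by omega] at h4
  -- The subtraction is truncated: the shift begins at `(K + (m - n), L)`, and the rest of the
  -- finite parts is added later. A zero here would mean `K = 0` and `m ≤ n`, that is `j ≤ n(i)`.
  · have hpos : 0 < K + (m - n : ℕ) := by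
      rw [pos_iff_ne_zero]
      intro h0
      obtain ⟨rfl, h0⟩ := Ordinal.add_eq_zero_iff.1 h0
      apply hfin
      rw [zero_add]
      norm_cast at h0 ⊢
      omega
    have hlt' : ∀ p : ℕ, K + p < L := by
      intro p
      induction p with
      | zero => simpa using hlt
      | succ p ih =>
        rw [Nat.cast_succ, ← add_assoc, ← succ_eq_add_one]
        exact h1.succ_lt ih
    have h4 := T.levelFailure_of_lt hadm hpos (hlt' _)
    rcases le_total n m with hnm | hmn
    · obtain ⟨p, rfl⟩ := Nat.exists_eq_add_of_le hnm
      rw [Nat.add_sub_cancel_left] at h4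
      have h5 := h4.add_natCast hκ n
      rwa [add_assoc, ← Nat.cast_add, Nat.add_comm p] at h5
    · obtain ⟨p, rfl⟩ := Nat.exists_eq_add_of_le hmn
      rw [Nat.sub_eq_zero_of_le hmn, Nat.cast_zero, add_zero] at h4
      have h5 := (h4.add_natCast_right hκ k1 p).add_natCast hκ m
      rwa [add_assoc, ← Nat.cast_add, Nat.add_comm p] at h5

end GhostChain

theorem proposition7p14 (κ : WithTop Cardinal.{u}) (hκ : GhostChain.BoundRegular κ) :
    (∀ j : Ordinal.{u},
      (∀ (X : Type u) (r : X → X → Prop) (x : X), GhostChain.IsBranching κ r x →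
        GhostChain.Approx r GhostChain.Step j x ⟨j, GhostChain.coalgProj r j x⟩) ↔
      (GhostChain.BoundLE κ j ∨ GhostChain.Extensible κ (GhostChain.limitPart j))) ∧
    (∀ (j i : Ordinal.{u}) (hji : j ≤ i),
      (∀ a : (GhostChain.finalChain κ).level i,
        GhostChain.Approx GhostChain.Step GhostChain.Step j
          ⟨j, GhostChain.incl ((GhostChain.finalChain κ).conn hji a)⟩
          ⟨i, GhostChain.incl a⟩) ↔
      (j = i ∨ j ≤ GhostChain.finitePart i ∨ GhostChain.BoundLE κ j ∨
        (GhostChain.Extensible κ (GhostChain.limitPart j) ∧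
          GhostChain.Extensible κ (GhostChain.limitPart i)))) := by
  open GhostChain in
  have faithful : ∀ i, Extensible κ (limitPart i) → ∀ j, Faithful κ j i := fun i h =>
    (h.extensionProperty hκ).faithful_of_limitPart
  refine ⟨fun j => ⟨fun h => ?_, fun h X r x hx => ?_⟩, fun j i hji => ⟨fun h => ?_, fun h a => ?_⟩⟩
  · by_contra! hj
    obtain ⟨X, r, x, hx, hne⟩ := systemFailure_of_not_extensible hκ hj.1 hj.2
    exact hne (approx_iff_proj_eq.1 (h X r x hx)).symm
  · refine approx_iff_proj_eq.2 (Eq.symm ?_)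
    rcases h with ⟨c, rfl, hcj⟩ | h
    · exact proj_step_proj_eq (hκ c rfl) j hx hcj
    · exact (faithful j h j le_rfl _ (Raw.proj_mem_level r j x hx)).trans (Raw.conn_self _ _)
  · by_contra! hj
    obtain ⟨hne, hfin, hbd, hext⟩ := hj
    -- If `L(i)` is extensible, `L(j)` is not. A system failing at `j` has a faithful image at level
    -- `i`, and this image is the counterexample.
    by_cases hi : Extensible κ (limitPart i)
    · obtain ⟨X, r, x, hx, hne⟩ := systemFailure_of_not_extensible hκ hbd fun h => hext h hi
      have hmem := Raw.proj_mem_level r i x hx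
      have e := approx_iff_proj_eq.1 (h ⟨Raw.proj r i x, hmem⟩)
      change Raw.proj Step j (node (Raw.conn i j hji (Raw.proj r i x)) _) =
        Raw.proj Step j (node (Raw.proj r i x) _) at e
      rw [faithful i hi j hji _ hmem] at e
      exact hne ((proj_node_congr (Raw.conn_proj r i x j hji).symm).trans
        (e.trans (Raw.conn_proj r i x j hji)))
    · obtain ⟨hji', a, ha, hne⟩ := levelFailure_of_not_extensible hκ (lt_of_le_of_ne hji hne) hbd
        hfin.not_ge hi
      exact hne (approx_iff_proj_eq.1 (h ⟨a, ha⟩))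
  · obtain ⟨a, ha⟩ := a
    refine approx_iff_proj_eq.2 ?_
    change Raw.proj Step j (node (Raw.conn i j hji a) _) = Raw.proj Step j (node a _)
    rcases h with rfl | h | ⟨c, rfl, hcj⟩ | ⟨hj, hi⟩
    · simp only [Raw.conn_self]
    -- Here `j` is finite and equals its own finite part, so both levels are faithful up to stage
    -- `j`.
    · have hfin : j < ω := h.trans_lt (Ordinal.mod_lt i omega0_ne_zero)
      have hj : j ≤ finitePart j := (Ordinal.mod_eq_of_lt hfin).ge
      rw [faithful_of_le_finitePart κ h hji a ha,
        faithful_of_le_finitePart κ hj le_rfl _ (Raw.conn_mem ha hji), Raw.conn_self]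
    · exact proj_step_conn_eq (hκ c rfl) j ha hcj hji
    · rw [faithful i hi j hji a ha, faithful j hj j le_rfl _ (Raw.conn_mem ha hji), Raw.conn_self]
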